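/- Conventions. A partial function $F:\subseteq\mathbb N^{\mathbb N}\to\mathbb N^{\mathbb N}$ is computable if there is a computable function $f:\mathbb N^*\to\mathbb N^*$ on finite words, monotone for the prefix order, with $F(p)=\sup_{w\sqsubseteq p}f(w)$ for all $p\in\mathrm{dom}(F)$. A representation of a set $X$ is a surjective partial map $\delta_X:\subseteq\mathbb N^{\mathbb N}\to X$. For a multi-valued function $f:\subseteq X\rightrightarrows Y$ on represented spaces, a realizer of $f$ is a partial $F:\subseteq\mathbb N^{\mathbb N}\to\mathbb N^{\mathbb N}$ with $\delta_Y F(p)\in f(\delta_X(p))$ whenever $\delta_X(p)\in\mathrm{dom}(f)$; $f$ is computable if it has a computable realizer. One writes $f\le_{\mathrm{sW}}g$ ($f$ is strongly Weihrauch reducible to $g$) if there are computable $H,K:\subseteq\mathbb N^{\mathbb N}\to\mathbb N^{\mathbb N}$ such that $H\circ G\circ K$ is a realizer of $f$ for every realizer $G$ of $g$, and $f\equiv_{\mathrm{sW}}g$ if $f\le_{\mathrm{sW}}g$ and $g\le_{\mathrm{sW}}f$. $\mathsf{LLPO}:\subseteq\mathbb N^{\mathbb N}\rightrightarrows\mathbb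 N$ has as its domain the set of all $p$ such that $p(k)\neq0$ for at most one $k$, and $0\in\mathsf{LLPO}(p)\iff(\forall n)\,p(2n)=0$, $1\in\mathsf{LLPO}(p)\iff(\forall n)\,p(2n+1)=0$, with no other values; here $\mathbb N^{\mathbb N}$ is represented by the identity and $\mathbb N$ by $p\mapsto p(0)$. Its parallelization is $\widehat{\mathsf{LLPO}}:\subseteq(\mathbb N^{\mathbb N})^{\mathbb N}\rightrightarrows\mathbb N^{\mathbb N}$, $(p_i)_i\mapsto\prod_i\mathsf{LLPO}(p_i)$, where a name of a sequence $(x_i)_i$ is $\langle q_0,q_1,\dots\rangle$ with $q_i$ a name of $x_i$ and $\langle q_0,q_1,\dots\rangle\langle i,k\rangle=q_i(k)$ for a standard computable pairing $\langle i,k\rangle$ of natural numbers. A computable metric space is a metric space $(X,d)$ with a dense sequence $\alpha:\mathbb N\to X$ such that $(d(\alpha(i),\alpha(j)))_{i,j}$ is a computable double sequence of reals. Its points carry the Cauchy representation: $p$ is a name of $x$ if $d(\alpha(p(i)),\alpha(p(j)))\le2^{-i}$ for all $i\le j$ and $\alpha(p(i))\to x$. The set $\mathcal K_-(X)$ of compact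 subsets of $X$ carries the negative information representation: a name of $K$ is a list of (codes of) all finite covers of $K$ by open balls with centres $\alpha(i)$ and positive rational radii. Compact choice is $\mathsf C_{\mathcal K(X)}:\subseteq\mathcal K_-(X)\rightrightarrows X$, $A\mapsto A$, with domain the set of nonempty compact subsets of $X$. The space $X$ is rich if there is a computable embedding $\iota:\{0,1\}^{\mathbb N}\hookrightarrow X$ (equivalently, a computable injective map), where $\{0,1\}^{\mathbb N}\subseteq\mathbb N^{\mathbb N}$ is represented by the restricted identity. Theorem (Compact choice). Let $X$ be a computable metric space. Then $\mathsf C_{\mathcal K(X)}\le_{\mathrm{sW}}\widehat{\mathsf{LLPO}}$. If $X$ is rich, then $\mathsf C_{\mathcal K(X)}\equiv_{\mathrm{sW}}\widehat{\mathsf{LLPO}}$. -/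

import Mathlib

namespace CompAnalysis

/-- The initial segment `p(0), …, p(n-1)` of a point of Baire space. -/
def initSeg (p : ℕ → ℕ) (n : ℕ) : List ℕ := (List.range n).map p

/-- A partial function `F` on Baire space is computable: there is a computable, prefix-monotone
function `f` on finite words with `F(p) = sup_{w ⊑ p} f(w)` for all `p ∈ dom F`. -/
def ComputableFun (F : (ℕ → ℕ) →. (ℕ → ℕ)) : Prop :=
  ∃ f : List ℕ → List ℕ, Computable f ∧ (∀ u v, u <+: v → f u <+: f v) ∧
    ∀ p q, q ∈ F p →
      (∀ n, f (initSeg p n) = initSeg q (f (initSeg p n)).length) ∧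
      ∀ m, ∃ n, m ≤ (f (initSeg p n)).length

/-- A representation of `X`: a surjective partial map from Baire space onto `X`, given by
its graph: `IsName p x` says that `p ∈ dom δ` and `δ p = x`. -/
structure Representation (X : Type*) where
  IsName : (ℕ → ℕ) → X → Prop
  unique : ∀ p x y, IsName p x → IsName p y → x = y
  surjective : ∀ x, ∃ p, IsName p x

/-- A multi-valued function `f :⊆ X ⇉ Y` between the represented spaces `(X, δX)`, `(Y, δY)`;
its domain consists of the points whose set of values is nonempty. -/
structure MultiMap {X Y : Type*} (δX : Representation X) (δY : Representation Y) where
  val : X → Set Y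

section Reducibility

variable {X Y U V : Type*} {δX : Representation X} {δY : Representation Y}
  {δU : Representation U} {δV : Representation V}

/-- The domain of a multi-valued function. -/
def MultiMap.dom (f : MultiMap δX δY) : Set X := {x | (f.val x).Nonempty}

/-- `F ⊢ f`: the partial function `F` on Baire space is a realizer of `f`. -/
def Realizes (F : (ℕ → ℕ) →. (ℕ → ℕ)) (f : MultiMap δX δY) : Prop :=
  ∀ p x, δX.IsName p x → x ∈ f.dom → ∃ q ∈ F p, ∃ y ∈ f.val x, δY.IsName q y

/-- Strong Weihrauch reducibility of multi-valued functions on represented spaces: there are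
computable `H`, `K` such that `H ∘ G ∘ K` is a realizer of `f` for every realizer `G` of `g`. -/
def StrongReducible (f : MultiMap δX δY) (g : MultiMap δU δV) : Prop :=
  ∃ H K : (ℕ → ℕ) →. (ℕ → ℕ), ComputableFun H ∧ ComputableFun K ∧
    ∀ G : (ℕ → ℕ) →. (ℕ → ℕ), Realizes G g → Realizes (H.comp (G.comp K)) f

/-- Strong Weihrauch equivalence. -/
def StrongEquiv (f : MultiMap δX δY) (g : MultiMap δU δV) : Prop :=
  StrongReducible f g ∧ StrongReducible g f

/-- A total single-valued function between represented spaces, as a multi-valued function. -/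
def ofFun (δX : Representation X) (δY : Representation Y) (f : X → Y) : MultiMap δX δY :=
  ⟨fun x => {f x}⟩

/-- A multi-valued function is computable if it has a computable realizer. -/
def MultiMap.IsComputable (f : MultiMap δX δY) : Prop :=
  ∃ F : (ℕ → ℕ) →. (ℕ → ℕ), ComputableFun F ∧ Realizes F f

end Reducibility

/-- The identity representation of Baire space. -/
def baireRep : Representation (ℕ → ℕ) where
  IsName p x := p = x
  unique := by rintro p x y rfl rfl; rfl
  surjective x := ⟨x, rfl⟩

/-- The representation `δ_ℕ(p) = p(0)` of the natural numbers. -/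
def natRep : Representation ℕ where
  IsName p x := p 0 = x
  unique := by rintro p x y rfl rfl; rfl
  surjective x := ⟨fun _ => x, rfl⟩

/-- Cantor space `{0,1}^ℕ`, represented by the identity restricted to binary sequences. -/
def cantorRep : Representation (ℕ → Bool) where
  IsName p x := ∀ n, p n = (x n).toNat
  unique := by
    intro p x y hx hy
    funext n
    have h := (hx n).symm.trans (hy n)
    revert h
    cases x n <;> cases y n <;> simp
  surjective x := ⟨fun n => (x n).toNat, fun _ => rfl⟩

/-- The representation `δ^ℕ` of the sequence space `X^ℕ`: a name of `(x_i)` is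
`⟨p_0, p_1, …⟩` with `p_i` a name of `x_i`, where `⟨p_0, p_1, …⟩⟨i, k⟩ = p_i(k)`. -/
def Representation.seq {X : Type*} (δ : Representation X) : Representation (ℕ → X) where
  IsName p x := ∀ i, δ.IsName (fun k => p (Nat.pair i k)) (x i)
  unique p x y hx hy := funext fun i => δ.unique _ _ _ (hx i) (hy i)
  surjective x := by
    choose q hq using fun i => δ.surjective (x i)
    exact ⟨fun n => q n.unpair.1 n.unpair.2, fun i => by simpa using hq i⟩

/-- The parallelization of a multi-valued function. -/
def MultiMap.parallelization {X Y : Type*} {δX : Representation X} {δY : Representation Y}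
    (f : MultiMap δX δY) : MultiMap δX.seq δY.seq :=
  ⟨fun x => {y | ∀ i, y i ∈ f.val (x i)}⟩

/-- The lesser limited principle of omniscience, with domain the set of all `p` with
`p(k) ≠ 0` for at most one `k`. -/
def LLPO : MultiMap baireRep natRep :=
  ⟨fun p => {i | (∀ j k, p j ≠ 0 → p k ≠ 0 → j = k) ∧
    ((i = 0 ∧ ∀ n, p (2 * n) = 0) ∨ (i = 1 ∧ ∀ n, p (2 * n + 1) = 0))}⟩

/-- A computable metric space structure on `X`: a dense sequence `α` such that
`d(α_i, α_j)` is a computable double sequence of reals, i.e. there is a computable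
triple sequence of rationals `(a - b)/(c + 1)` approximating it with error `2^{-n}`. -/
structure ComputableMetric (X : Type*) [MetricSpace X] where
  α : ℕ → X
  dense : DenseRange α
  computable_dist : ∃ a b c : ℕ × ℕ × ℕ → ℕ, Computable a ∧ Computable b ∧ Computable c ∧
    ∀ i j n, |((a (i, j, n) : ℝ) - (b (i, j, n) : ℝ)) / ((c (i, j, n) : ℝ) + 1)
      - dist (α i) (α j)| ≤ (2 : ℝ)⁻¹ ^ n

namespace ComputableMetric

variable {X : Type*} [MetricSpace X] (C : ComputableMetric X)

/-- The Cauchy representation: names are the rapidly converging sequences of indices. -/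
def cauchyRep : Representation X where
  IsName p x := (∀ i j, i ≤ j → dist (C.α (p i)) (C.α (p j)) ≤ (2 : ℝ)⁻¹ ^ i) ∧
    Filter.Tendsto (fun i => C.α (p i)) Filter.atTop (nhds x)
  unique p x y hx hy := tendsto_nhds_unique hx.2 hy.2
  surjective x := by
    have h : ∀ i : ℕ, ∃ k, dist x (C.α k) < (2 : ℝ)⁻¹ ^ (i + 1) := fun i =>
      C.dense.exists_dist_lt x (by positivity)
    choose p hp using h
    refine ⟨p, fun i j hij => ?_, ?_⟩
    · have h1 := hp i
      have h2 := hp j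
      have h3 : (2 : ℝ)⁻¹ ^ (j + 1) ≤ (2 : ℝ)⁻¹ ^ (i + 1) :=
        pow_le_pow_of_le_one (by norm_num) (by norm_num) (by omega)
      have h4 : (2 : ℝ)⁻¹ ^ (i + 1) = (2 : ℝ)⁻¹ ^ i * 2⁻¹ := pow_succ _ _
      have h5 := dist_triangle_left (C.α (p i)) (C.α (p j)) x
      linarith
    · rw [tendsto_iff_dist_tendsto_zero]
      have hlim : Filter.Tendsto (fun i : ℕ => (2 : ℝ)⁻¹ ^ (i + 1)) Filter.atTop (nhds 0) :=
        (tendsto_pow_atTop_nhds_zero_of_lt_one (by norm_num) (by norm_num)).comp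
          (Filter.tendsto_add_atTop_nat 1)
      exact squeeze_zero (fun _ => dist_nonneg)
        (fun i => by rw [dist_comm]; exact (hp i).le) hlim

/-- The open rational ball with index `(c, i, j)`: centre `α_c`, radius `(i+1)/(j+1)`. -/
def ratBall (t : ℕ × ℕ × ℕ) : Set X :=
  Metric.ball (C.α t.1) (((t.2.1 : ℝ) + 1) / ((t.2.2 : ℝ) + 1))

/-- The finite list `w` of indices of open rational balls is a cover of `K`. -/
def IsCover (w : List (ℕ × ℕ × ℕ)) (K : Set X) : Prop := K ⊆ ⋃ t ∈ w, C.ratBall t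

theorem exists_ratBall (y : X) {ε : ℝ} (hε : 0 < ε) :
    ∃ t, y ∈ C.ratBall t ∧ ∀ z ∈ C.ratBall t, dist z y < ε := by
  obtain ⟨n, hn⟩ := exists_nat_one_div_lt (half_pos hε)
  have hpos : (0 : ℝ) < 1 / ((n : ℝ) + 1) := by positivity
  obtain ⟨c, hc⟩ := C.dense.exists_dist_lt y hpos
  refine ⟨(c, 0, n), by simpa [ratBall] using hc, fun z hz => ?_⟩
  have hz' : dist z (C.α c) < 1 / ((n : ℝ) + 1) := by simpa [ratBall] using hz
  have := dist_triangle_right z y (C.α c)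
  linarith

theorem exists_cover {K : Set X} (hK : IsCompact K) {ε : X → ℝ} (hε : ∀ y ∈ K, 0 < ε y) :
    ∃ w, C.IsCover w K ∧ ∀ t ∈ w, ∃ y ∈ K, ∀ z ∈ C.ratBall t, dist z y < ε y := by
  classical
  choose! t ht using fun (y : X) (hy : y ∈ K) => C.exists_ratBall y (hε y hy)
  obtain ⟨s, hs, hcov⟩ := hK.elim_nhds_subcover (fun y => C.ratBall (t y))
    (fun y hy => Metric.isOpen_ball.mem_nhds (ht y hy).1)
  refine ⟨s.toList.map t, fun x hx => ?_, ?_⟩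
  · obtain ⟨y, hy, hxy⟩ := Set.mem_iUnion₂.1 (hcov hx)
    exact Set.mem_iUnion₂.2 ⟨t y, List.mem_map.2 ⟨y, by simpa using hy, rfl⟩, hxy⟩
  · intro u hu
    obtain ⟨y, hy, rfl⟩ := List.mem_map.1 hu
    have hy' : y ∈ K := hs y (by simpa using hy)
    exact ⟨y, hy', (ht y hy').2⟩

theorem subset_of_covers {K L : Set X} (hL : IsCompact L)
    (h : ∀ w, C.IsCover w L → C.IsCover w K) : K ⊆ L := by
  intro x hx
  by_contra hxL
  obtain ⟨w, hw, hw'⟩ := C.exists_cover hL (ε := fun y => dist x y)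
    (fun y hy => dist_pos.2 (fun e => hxL (e ▸ hy)))
  obtain ⟨t, ht, hxt⟩ := Set.mem_iUnion₂.1 (h w hw hx)
  obtain ⟨y, -, hy⟩ := hw' t ht
  exact lt_irrefl _ (hy x hxt)

/-- The negative information representation `κ₋` of the compact subsets of `X` (the empty
set included): a name of `K` is a list of (codes of) all finite covers of `K` by open
rational balls. -/
def compactRep : Representation (TopologicalSpace.Compacts X) where
  IsName p K := Set.range p =
    (Encodable.encode : List (ℕ × ℕ × ℕ) → ℕ) '' {w | C.IsCover w (K : Set X)}
  unique := by
    intro p K L hK hL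
    have h : {w | C.IsCover w (K : Set X)} = {w | C.IsCover w (L : Set X)} :=
      (Set.image_injective.2 Encodable.encode_injective) (hK.symm.trans hL)
    apply TopologicalSpace.Compacts.ext
    exact Set.Subset.antisymm
      (C.subset_of_covers L.isCompact fun w hw => (Set.ext_iff.1 h w).2 hw)
      (C.subset_of_covers K.isCompact fun w hw => (Set.ext_iff.1 h w).1 hw)
  surjective := by
    intro K
    obtain ⟨w, hw, -⟩ := C.exists_cover K.isCompact (ε := fun _ => 1) (fun _ _ => one_pos)
    obtain ⟨p, hp⟩ := (Set.to_countable ((Encodable.encode : List (ℕ × ℕ × ℕ) → ℕ) ''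
      {w | C.IsCover w (K : Set X)})).exists_eq_range ⟨_, w, hw, rfl⟩
    exact ⟨p, hp.symm⟩

/-- Compact choice `C_{𝒦(X)} : A ↦ A`; its domain is the set of nonempty compact sets. -/
def compactChoice : MultiMap C.compactRep C.cauchyRep := ⟨fun A => (A : Set X)⟩

/-- `X` is rich: there is a computable injection of Cantor space into `X` (being computable
it is continuous, hence by compactness it is a topological embedding). -/
def IsRich : Prop :=
  ∃ ι : (ℕ → Bool) → X, Function.Injective ι ∧ (ofFun cantorRep C.cauchyRep ι).IsComputable

end ComputableMetric

end CompAnalysis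

/-! Compact choice reduces to parallel `LLPO` by a binary search that never backtracks. A state `(l,
c)` records the dense points already chosen as approximations and the index currently tried as the
next one. Its two refinements accept `c` or pass to `c + 1`. The closed conditions attached to the
refinements overlap, so if `K` meets `stateSet s`, it also meets the set of one refinement
(`stateSet_child`). Missing a compact `K` is recognizable from a list of its covers: some cover
consists of balls formally disjoint from the closed set (`exists_kill`). Hence "which refinement
survives?" is an `LLPO` question. Since every state has a code, the questions for all states are
asked in parallel, before it is known which states matter (`exists_queries`). The answers alone
steer the search, as a strong reduction requires. Compactness is used twice more: finitely many
small balls around dense points cover `K`, so some candidate is eventually accepted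
(`exists_lt_length_path`), and nested nonempty compact sets intersect, so the choices converge to a
point of `K` (`exists_mem_forall_dist_le`).

Conversely, let `ι` be a computable injection of Cantor space. The binary solutions of a sequence of
`LLPO` instances form a nonempty closed set, whose image under `ι` is compact by continuity. By the
fan theorem (`fan`), a finite list of balls covers this image exactly when, at some level `n`, each
binary word of length `n` either violates the instances or visibly maps into a listed ball; so all
covers can be enumerated (`exists_mem_produce_coverOfWord`). Compact choice returns a name of some
`ι a`. Injectivity and the fan theorem recover each bit of `a`: at some level all words without the
right bit are visibly separated from the given point (`exists_mem_produce_bitOfWord`). -/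

namespace CompAnalysis

/-! ### Closure properties of computable functions -/

section Computability

variable {α β : Type*} [Primcodable α] [Primcodable β]

theorem computable_lt {f g : α → ℕ} (hf : Computable f) (hg : Computable g) :
    Computable fun a => decide (f a < g a) :=
  (Primrec.nat_lt.decide.to_comp).comp hf hg

theorem computable_beq [DecidableEq β] {f g : α → β} (hf : Computable f) (hg : Computable g) :
    Computable fun a => decide (f a = g a) :=
  (Primrec.eq.decide.to_comp).comp hf hg

theorem computable_and {f g : α → Bool} (hf : Computable f) (hg : Computable g) :
    Computable fun a => f a && g a :=
  (Primrec.and.to_comp).comp hf hg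

theorem computable_or {f g : α → Bool} (hf : Computable f) (hg : Computable g) :
    Computable fun a => f a || g a :=
  (Primrec.or.to_comp).comp hf hg

theorem computable_not {f : α → Bool} (hf : Computable f) : Computable fun a => !f a :=
  (Primrec.not.to_comp).comp hf

theorem computable_add {f g : α → ℕ} (hf : Computable f) (hg : Computable g) :
    Computable fun a => f a + g a :=
  (Primrec.nat_add.to_comp).comp hf hg

theorem computable_mul {f g : α → ℕ} (hf : Computable f) (hg : Computable g) :
    Computable fun a => f a * g a :=
  (Primrec.nat_mul.to_comp).comp hf hg

theorem computable_two_pow {f : α → ℕ} (hf : Computable f) : Computable fun a => 2 ^ f a :=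
  ((Computable.nat_rec hf (Computable.const 1)
    ((computable_mul (Computable.const 2) (Computable.snd.comp Computable.snd)).to₂ :
      Computable₂ fun (_ : α) (y : ℕ × ℕ) => 2 * y.2))).of_eq fun a => by
    induction f a with
    | zero => rfl
    | succ n ih => simp only [ih]; ring

theorem computable_take {f : α → List β} {n : α → ℕ} (hf : Computable f) (hn : Computable n) :
    Computable fun a => (f a).take (n a) :=
  (Primrec.list_take.to_comp).comp hn hf

theorem computable_getElem? {f : α → List β} {n : α → ℕ} (hf : Computable f)
    (hn : Computable n) : Computable fun a => (f a)[n a]? :=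
  Computable.list_getElem?.comp hf hn

theorem computable_toList {f : α → Option β} (hf : Computable f) :
    Computable fun a => (f a).toList :=
  Primrec.optionToList.to_comp.comp hf

theorem computable_range {n : α → ℕ} (hn : Computable n) :
    Computable fun a => List.range (n a) :=
  Primrec.list_range.to_comp.comp hn

theorem computable_list_all {f : α → List β} {p : α × β → Bool} (hf : Computable f)
    (hp : Computable p) : Computable fun a => (f a).all fun b => p (a, b) := by
  -- The conjunction is built by recursion on the index; the default `true` makes missing entries
  -- harmless.
  have h : Computable₂ fun (a : α) (y : ℕ × Bool) =>
      y.2 && (((f a)[y.1]?).map fun b => p (a, b)).getD true := by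
    refine computable_and (Computable.snd.comp Computable.snd)
      (Computable.option_getD (Computable.option_map ?_ ?_) (Computable.const true))
    · exact computable_getElem? (hf.comp Computable.fst) (Computable.fst.comp Computable.snd)
    · exact hp.comp (Computable.pair (Computable.fst.comp Computable.fst) Computable.snd)
  refine (Computable.nat_rec (Computable.list_length.comp hf) (Computable.const true) h).of_eq
    fun a => ?_
  have key : ∀ n : ℕ, (Nat.rec true (fun y IH => IH &&
      (((f a)[y]?).map fun b => p (a, b)).getD true) n : Bool)
      = ((f a).take n).all fun b => p (a, b) := by
    intro n
    induction n with
    | zero => simp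
    | succ n ih =>
      rw [List.take_add_one, List.all_append, ← ih]
      cases hn : (f a)[n]? <;> simp [hn]
  have := key (f a).length
  rwa [List.take_length] at this

theorem computable_list_any {f : α → List β} {p : α × β → Bool} (hf : Computable f)
    (hp : Computable p) : Computable fun a => (f a).any fun b => p (a, b) :=
  (computable_not (computable_list_all hf (computable_not hp))).of_eq fun a => by
    rw [List.not_all_eq_any_not]; simp

end Computability

/-! ### Partial functions on Baire space from monotone word functions -/

section Words

theorem length_initSeg (p : ℕ → ℕ) (n : ℕ) : (initSeg p n).length = n := by simp [initSeg]

theorem take_initSeg (p : ℕ → ℕ) {k n : ℕ} (h : k ≤ n) :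
    (initSeg p n).take k = initSeg p k := by
  simp [initSeg, ← List.map_take, List.take_range, h]

theorem initSeg_prefix (p : ℕ → ℕ) {k n : ℕ} (h : k ≤ n) : initSeg p k <+: initSeg p n := by
  rw [← take_initSeg p h]; exact List.take_prefix _ _

theorem getElem?_initSeg (p : ℕ → ℕ) {k n : ℕ} (h : k < n) : (initSeg p n)[k]? = some (p k) := by
  simp [initSeg, h]

theorem getElem?_initSeg_eq_some {p : ℕ → ℕ} {k n v : ℕ} :
    (initSeg p n)[k]? = some v ↔ k < n ∧ p k = v := by
  by_cases h : k < n <;> simp [initSeg, h]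

theorem getElem?_of_prefix {β : Type*} {u v : List β} (h : u <+: v) {k : ℕ} {b : β}
    (hb : u[k]? = some b) : v[k]? = some b := by
  obtain ⟨w, rfl⟩ := h
  rw [List.getElem?_append_left (List.getElem?_eq_some_iff.1 hb).1, hb]

/-- The partial function on Baire space induced by a function on words. -/
noncomputable def ofWords (f : List ℕ → List ℕ) : (ℕ → ℕ) →. (ℕ → ℕ) := fun p =>
  ⟨∀ m, ∃ n, m < (f (initSeg p n)).length,
    fun h m => (f (initSeg p (h m).choose))[m]'(h m).choose_spec⟩

/-- By monotonicity any two outputs along `p` are comparable, so the stage chosen in `ofWords` is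
irrelevant. -/
theorem getElem?_of_mem_ofWords {f : List ℕ → List ℕ} (hf : ∀ u v, u <+: v → f u <+: f v)
    {p q : ℕ → ℕ} (h : q ∈ ofWords f p) {n m : ℕ} (hm : m < (f (initSeg p n)).length) :
    (f (initSeg p n))[m]? = some (q m) := by
  obtain ⟨hd, rfl⟩ := h
  set k := (hd m).choose with hk
  have h1 : (f (initSeg p k))[m]? = some ((f (initSeg p k))[m]'(hd m).choose_spec) :=
    List.getElem?_eq_getElem _
  change _ = some ((f (initSeg p k))[m]'(hd m).choose_spec)
  rcases le_total n k with h' | h'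
  · rw [← h1, List.getElem?_eq_getElem hm]
    exact (getElem?_of_prefix (hf _ _ (initSeg_prefix p h')) (List.getElem?_eq_getElem hm)).symm
  · exact getElem?_of_prefix (hf _ _ (initSeg_prefix p h')) h1

theorem computableFun_ofWords {f : List ℕ → List ℕ} (hc : Computable f)
    (hf : ∀ u v, u <+: v → f u <+: f v) : ComputableFun (ofWords f) := by
  refine ⟨f, hc, hf, fun p q hq => ⟨fun n => ?_, fun m => ?_⟩⟩
  · apply List.ext_getElem?
    intro m
    by_cases hm : m < (f (initSeg p n)).length
    · rw [getElem?_of_mem_ofWords hf hq hm, getElem?_initSeg q hm]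
    · rw [List.getElem?_eq_none (by omega), List.getElem?_eq_none]
      rw [length_initSeg]; omega
  · obtain ⟨hd, rfl⟩ := hq
    obtain ⟨n, hn⟩ := hd m
    exact ⟨n, hn.le⟩

/-- The first `n` rounds of the process that appends in round `k` the letter proposed by `g`
(if any), given the first `k + 1` letters of `u` and the number of letters written so far. -/
def produceAux (g : List ℕ × ℕ → Option ℕ) (u : List ℕ) (n : ℕ) : List ℕ :=
  Nat.rec [] (fun k out => out ++ (g (u.take (k + 1), out.length)).toList) n

/-- The monotone word function generated by a proposal function `g`. -/
def produce (g : List ℕ × ℕ → Option ℕ) (u : List ℕ) : List ℕ := produceAux g u u.length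

variable {g : List ℕ × ℕ → Option ℕ}

theorem computable_produce (hg : Computable g) : Computable (produce g) := by
  have h : Computable₂ fun (u : List ℕ) (y : ℕ × List ℕ) =>
      y.2 ++ (g (u.take (y.1 + 1), y.2.length)).toList := ?_
  · exact Computable.nat_rec Computable.list_length (Computable.const []) h
  refine Computable.list_append.comp (Computable.snd.comp Computable.snd)
    (computable_toList (hg.comp (Computable.pair ?_ ?_)))
  · exact computable_take Computable.fst
      (Computable.succ.comp (Computable.fst.comp Computable.snd))
  · exact Computable.list_length.comp (Computable.snd.comp Computable.snd)

theorem produceAux_prefix (u : List ℕ) {m n : ℕ} (h : m ≤ n) :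
    produceAux g u m <+: produceAux g u n := by
  induction n, h using Nat.le_induction with
  | base => exact List.prefix_refl _
  | succ n _ ih => exact ih.trans (List.prefix_append _ _)

theorem produceAux_congr {u v : List ℕ} (h : u <+: v) {n : ℕ} (hn : n ≤ u.length) :
    produceAux g u n = produceAux g v n := by
  induction n with
  | zero => rfl
  | succ n ih =>
    have h1 : u.take (n + 1) = v.take (n + 1) := by
      obtain ⟨w, rfl⟩ := h
      rw [List.take_append_of_le_length hn]
    have h2 := ih (by omega)
    simp only [produceAux] at h2 ⊢
    rw [h1, h2]

theorem produce_mono (u v : List ℕ) (h : u <+: v) : produce g u <+: produce g v := by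
  rw [produce, produceAux_congr h le_rfl]
  exact produceAux_prefix v h.length_le

theorem produce_initSeg_succ (p : ℕ → ℕ) (n : ℕ) :
    produce g (initSeg p (n + 1)) = produce g (initSeg p n) ++
      (g (initSeg p (n + 1), (produce g (initSeg p n)).length)).toList := by
  have h : produce g (initSeg p n) = produceAux g (initSeg p (n + 1)) n := by
    rw [produce, length_initSeg]
    exact produceAux_congr (initSeg_prefix p (by omega)) (by rw [length_initSeg])
  rw [h]
  conv_lhs => rw [produce, length_initSeg]
  simp only [produceAux]
  rw [take_initSeg p le_rfl]

theorem computableFun_produce (hg : Computable g) : ComputableFun (ofWords (produce g)) :=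
  computableFun_ofWords (computable_produce hg) produce_mono

/-- Proposals that keep coming for every position make the output infinite. The two further clauses
serve as soundness and completeness: each output letter was proposed for its own position, and each
round has a position at which its proposal, if any, is written. The latter matters when the output
is an enumeration. -/
theorem exists_mem_produce {p : ℕ → ℕ}
    (h : ∀ m N, ∃ n, N ≤ n ∧ (g (initSeg p n, m)).isSome) :
    ∃ q ∈ ofWords (produce g) p, (∀ m, ∃ n, g (initSeg p n, m) = some (q m)) ∧
      ∀ n, ∃ m, ∀ v, g (initSeg p (n + 1), m) = some v → q m = v := by
  have hd : ∀ m, ∃ n, m < (produce g (initSeg p n)).length := by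
    have : ∀ m, ∃ n, m ≤ (produce g (initSeg p n)).length := by
      intro m
      induction m with
      | zero => exact ⟨0, Nat.zero_le _⟩
      | succ m ih =>
        obtain ⟨N, hN⟩ := ih
        obtain ⟨n, hn, hs⟩ := h m (N + 1)
        obtain ⟨n, rfl⟩ : ∃ k, n = k + 1 := ⟨n - 1, by omega⟩
        refine ⟨n + 1, ?_⟩
        have h1 : m ≤ (produce g (initSeg p n)).length :=
          hN.trans (produce_mono _ _ (initSeg_prefix p (by omega))).length_le
        rw [produce_initSeg_succ, List.length_append]
        rcases h1.eq_or_lt with h2 | h2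
        · rw [← h2]
          obtain ⟨v, hv⟩ := Option.isSome_iff_exists.1 hs
          simp [hv]
        · omega
    exact fun m => this (m + 1)
  refine ⟨_, ⟨hd, rfl⟩, ?_⟩
  set q := (ofWords (produce g) p).get hd
  have hq : q ∈ ofWords (produce g) p := ⟨hd, rfl⟩
  have hget := fun n m => getElem?_of_mem_ofWords (produce_mono (g := g)) hq (n := n) (m := m)
  constructor
  · intro m
    classical
    -- At the first stage where the output is longer than `m`, the preceding output has length at
    -- most `m`. A round adds at most one letter, so letter `m` was proposed in exactly this round.
    have hm := Nat.find_spec (hd m)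
    set n := Nat.find (hd m) with hn
    obtain ⟨k, hk⟩ : ∃ k, n = k + 1 := by
      refine ⟨n - 1, ?_⟩
      rcases Nat.eq_zero_or_pos n with h0 | h0
      · rw [h0] at hm; simp [produce, produceAux, initSeg] at hm
      · omega
    have hk' : (produce g (initSeg p k)).length ≤ m :=
      not_lt.1 (Nat.find_min (hd m) (m := k) (by omega))
    rw [hk] at hm
    have hg := hget _ _ hm
    refine ⟨k + 1, ?_⟩
    rw [produce_initSeg_succ] at hm hg
    rw [List.getElem?_append_right hk'] at hg
    rw [List.length_append] at hm
    cases hc : g (initSeg p (k + 1), (produce g (initSeg p k)).length) with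
    | none => rw [hc] at hm; simp at hm; omega
    | some v =>
      rw [hc] at hm hg
      simp at hm
      have : m = (produce g (initSeg p k)).length := by omega
      subst this
      simpa [hc] using hg
  · intro n
    refine ⟨(produce g (initSeg p n)).length, fun v hv => ?_⟩
    have h1 := produce_initSeg_succ (g := g) p n
    rw [hv] at h1
    have := hget (n + 1) (produce g (initSeg p n)).length (by rw [h1]; simp)
    rw [h1] at this
    simpa using this.symm

end Words

/-! ### A binary search steered by `LLPO` -/

section Search

/-- The two refinements of a search state `(l, c)`, where `l` lists the choices made so far and
`c` is the current candidate for the next one: accept the candidate, or go on to `c + 1`. -/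
def child (s : List ℕ × ℕ) (b : Bool) : List ℕ × ℕ :=
  cond b (s.1, s.2 + 1) (s.1 ++ [s.2], 0)

theorem computable_child {α : Type*} [Primcodable α] {s : α → List ℕ × ℕ} {b : α → Bool}
    (hs : Computable s) (hb : Computable b) : Computable fun a => child (s a) (b a) :=
  Computable.cond hb
    (Computable.pair (Computable.fst.comp hs)
      (Computable.succ.comp (Computable.snd.comp hs)))
    (Computable.pair (Computable.list_concat.comp (Computable.fst.comp hs)
      (Computable.snd.comp hs)) (Computable.const 0))

theorem fst_prefix_child (s : List ℕ × ℕ) (b : Bool) : s.1 <+: (child s b).1 := by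
  cases b
  · exact List.prefix_append _ _
  · exact List.prefix_refl _

/-- The search steered by the answers coded in `q`. -/
def path (q : ℕ → ℕ) (n : ℕ) : List ℕ × ℕ :=
  Nat.rec ([], 0) (fun _ s => child s (decide (0 < q (Nat.pair (Encodable.encode s) 0)))) n

theorem path_succ (q : ℕ → ℕ) (n : ℕ) : path q (n + 1) =
    child (path q n) (decide (0 < q (Nat.pair (Encodable.encode (path q n)) 0))) := rfl

theorem path_prefix (q : ℕ → ℕ) {m n : ℕ} (h : m ≤ n) : (path q m).1 <+: (path q n).1 := by
  induction n, h using Nat.le_induction with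
  | base => exact List.prefix_refl _
  | succ n _ ih => exact ih.trans (fst_prefix_child _ _)

/-- The search steered by the answers coded in a finite word, which halts as soon as an answer
is not available. -/
def wordPath (u : List ℕ) (n : ℕ) : List ℕ × ℕ :=
  Nat.rec ([], 0) (fun _ s => ((u[Nat.pair (Encodable.encode s) 0]?).map
    fun a => child s (decide (0 < a))).getD s) n

theorem computable_wordPath : Computable fun u : List ℕ => wordPath u u.length := by
  have h : Computable₂ fun (u : List ℕ) (y : ℕ × (List ℕ × ℕ)) =>
      ((u[Nat.pair (Encodable.encode y.2) 0]?).map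
        fun a => child y.2 (decide (0 < a))).getD y.2 := ?_
  · exact Computable.nat_rec Computable.list_length (Computable.const ([], 0)) h
  refine Computable.option_getD (Computable.option_map ?_ ?_) (Computable.snd.comp Computable.snd)
  · refine computable_getElem? Computable.fst ?_
    exact Primrec₂.natPair.to_comp.comp
      (Computable.encode.comp (Computable.snd.comp Computable.snd)) (Computable.const 0)
  · exact computable_child (Computable.snd.comp (Computable.snd.comp Computable.fst))
      (computable_lt (Computable.const 0) Computable.snd)

theorem wordPath_succ (u : List ℕ) (n : ℕ) : wordPath u (n + 1) =
    ((u[Nat.pair (Encodable.encode (wordPath u n)) 0]?).map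
      fun a => child (wordPath u n) (decide (0 < a))).getD (wordPath u n) := rfl

/-- A missing answer only stalls the search and never misdirects it; this gives soundness of the
choices read off from finite words. -/
theorem exists_wordPath_eq_path (q : ℕ → ℕ) (N n : ℕ) :
    ∃ k, wordPath (initSeg q N) n = path q k := by
  induction n with
  | zero => exact ⟨0, rfl⟩
  | succ n ih =>
    obtain ⟨k, hk⟩ := ih
    rw [wordPath_succ, hk]
    by_cases h : Nat.pair (Encodable.encode (path q k)) 0 < N
    · exact ⟨k + 1, by rw [getElem?_initSeg q h]; rfl⟩
    · refine ⟨k, ?_⟩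
      rw [List.getElem?_eq_none (by rw [length_initSeg]; omega)]
      rfl

theorem wordPath_prefix (u : List ℕ) {m n : ℕ} (h : m ≤ n) :
    (wordPath u m).1 <+: (wordPath u n).1 := by
  induction n, h using Nat.le_induction with
  | base => exact List.prefix_refl _
  | succ n _ ih =>
    refine ih.trans ?_
    rw [wordPath_succ]
    cases u[Nat.pair (Encodable.encode (wordPath u n)) 0]?
    · exact List.prefix_refl _
    · exact fst_prefix_child _ _

theorem exists_forall_wordPath_eq (q : ℕ → ℕ) (n : ℕ) :
    ∃ N₀, ∀ N, N₀ ≤ N → wordPath (initSeg q N) n = path q n := by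
  induction n with
  | zero => exact ⟨0, fun _ _ => rfl⟩
  | succ n ih =>
    obtain ⟨N₀, h⟩ := ih
    refine ⟨max N₀ (Nat.pair (Encodable.encode (path q n)) 0 + 1), fun N hN => ?_⟩
    rw [wordPath_succ, h N (by omega), getElem?_initSeg q (by omega)]
    rfl

/-- The `m`-th choice, as far as it is determined by a word of answers. -/
def choiceOfWord (a : List ℕ × ℕ) : Option ℕ := (wordPath a.1 a.1.length).1[a.2]?

theorem computable_choiceOfWord : Computable choiceOfWord :=
  computable_getElem? (Computable.fst.comp (computable_wordPath.comp Computable.fst))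
    Computable.snd

/-- The lists along the search extend one another, so a choice, once made, is final and can be
output as soon as enough answers are known. -/
theorem exists_mem_produce_choiceOfWord {q : ℕ → ℕ} (h : ∀ m, ∃ n, m < (path q n).1.length) :
    ∃ r ∈ ofWords (produce choiceOfWord) q,
      ∀ n m v, (path q n).1[m]? = some v → r m = v := by
  obtain ⟨r, hr, hr', -⟩ := exists_mem_produce (g := choiceOfWord) (p := q) (by
    intro m N
    obtain ⟨n, hn⟩ := h m
    obtain ⟨N₀, hN₀⟩ := exists_forall_wordPath_eq q n
    refine ⟨max N (max N₀ n), le_max_left _ _, ?_⟩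
    have h1 := hN₀ (max N (max N₀ n)) (by omega)
    have h2 := wordPath_prefix (initSeg q (max N (max N₀ n)))
      (m := n) (n := max N (max N₀ n)) (by omega)
    rw [h1] at h2
    rw [choiceOfWord, length_initSeg,
      getElem?_of_prefix h2 (List.getElem?_eq_getElem hn)]
    rfl)
  refine ⟨r, hr, fun n m v hv => ?_⟩
  obtain ⟨N, hN⟩ := hr' m
  obtain ⟨k, hk⟩ := exists_wordPath_eq_path q N (initSeg q N).length
  simp only [choiceOfWord, hk] at hN
  rcases le_total n k with h | h
  · have := getElem?_of_prefix (path_prefix q h) hv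
    rw [hN] at this
    exact Option.some_injective _ this
  · have := getElem?_of_prefix (path_prefix q h) hN
    rw [hv] at this
    exact (Option.some_injective _ this).symm

/-- Whether the state `s` is refuted by some letter of the word `u`. -/
def refuted (kill : ℕ × (List ℕ × ℕ) → Bool) (u : List ℕ) (s : List ℕ × ℕ) : Bool :=
  u.any fun x => kill (x, s)

/-- The `k`-th entry of the instance of `LLPO` that asks which of the two refinements of the
state `s` is not refuted: it is nonzero if at stage `k / 2` the refinement with index
`k mod 2` is refuted for the first time and the other one has not been refuted. -/
def query (kill : ℕ × (List ℕ × ℕ) → Bool) (u : List ℕ) (s : List ℕ × ℕ) (k : ℕ) : ℕ :=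
  cond ((refuted kill (u.take (k.div2 + 1)) (child s k.bodd) &&
    !refuted kill (u.take k.div2) (child s k.bodd)) &&
    !refuted kill (u.take (k.div2 + 1)) (child s (!k.bodd))) 1 0

/-- All queries, computed from finite words. -/
def queryOfWord (kill : ℕ × (List ℕ × ℕ) → Bool) (a : List ℕ × ℕ) : Option ℕ :=
  cond (decide (a.2 < a.1.length))
    (some (query kill a.1 (Denumerable.ofNat _ a.2.unpair.1) a.2.unpair.2)) none

variable {kill : ℕ × (List ℕ × ℕ) → Bool}

theorem computable_refuted {α : Type*} [Primcodable α] (hk : Computable kill)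
    {u : α → List ℕ} {s : α → List ℕ × ℕ} (hu : Computable u) (hs : Computable s) :
    Computable fun a => refuted kill (u a) (s a) :=
  computable_list_any (p := fun y : α × ℕ => kill (y.2, s y.1)) hu
    (hk.comp (Computable.pair Computable.snd (hs.comp Computable.fst)))

theorem computable_queryOfWord (hk : Computable kill) : Computable (queryOfWord kill) := by
  have hs : Computable fun a : List ℕ × ℕ =>
      Denumerable.ofNat (List ℕ × ℕ) a.2.unpair.1 :=
    (Computable.ofNat _).comp (Computable.fst.comp (Computable.unpair.comp Computable.snd))
  have hq : Computable fun a : List ℕ × ℕ => a.2.unpair.2 :=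
    Computable.snd.comp (Computable.unpair.comp Computable.snd)
  have hb := Computable.nat_bodd.comp hq
  have hd := Computable.nat_div2.comp hq
  refine Computable.cond
    (computable_lt Computable.snd (Computable.list_length.comp Computable.fst))
    (Computable.option_some.comp ?_) (Computable.const none)
  refine Computable.cond (computable_and (computable_and ?_ (computable_not ?_))
    (computable_not ?_)) (Computable.const 1) (Computable.const 0)
  · exact computable_refuted hk
      (computable_take Computable.fst (Computable.succ.comp hd)) (computable_child hs hb)
  · exact computable_refuted hk (computable_take Computable.fst hd) (computable_child hs hb)
  · exact computable_refuted hk (computable_take Computable.fst (Computable.succ.comp hd))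
      (computable_child hs (computable_not hb))

theorem refuted_mono {u v : List ℕ} (h : u <+: v) {s : List ℕ × ℕ}
    (hu : refuted kill u s = true) : refuted kill v s = true := by
  obtain ⟨w, rfl⟩ := h
  simp only [refuted, List.any_append, Bool.or_eq_true] at hu ⊢
  exact Or.inl hu

theorem query_ne_zero {p : ℕ → ℕ} {N : ℕ} {s : List ℕ × ℕ} {k : ℕ} (hN : k < N) :
    query kill (initSeg p N) s k ≠ 0 ↔
      refuted kill (initSeg p (k.div2 + 1)) (child s k.bodd) = true ∧
      refuted kill (initSeg p k.div2) (child s k.bodd) = false ∧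
      refuted kill (initSeg p (k.div2 + 1)) (child s (!k.bodd)) = false := by
  have h := Nat.div2_val k
  -- From `k < N` follows `k.div2 + 1 ≤ N`, so truncating the prefix loses nothing that the query
  -- needs.
  rw [query, take_initSeg p (by omega), take_initSeg p (by omega)]
  cases refuted kill (initSeg p (k.div2 + 1)) (child s k.bodd) <;>
  cases refuted kill (initSeg p k.div2) (child s k.bodd) <;>
  cases refuted kill (initSeg p (k.div2 + 1)) (child s (!k.bodd)) <;> simp

theorem LLPO_val_nonempty {p : ℕ → ℕ} (h : ∀ j k, p j ≠ 0 → p k ≠ 0 → j = k) :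
    (LLPO.val p).Nonempty := by
  by_cases h0 : ∃ n, p (2 * n) ≠ 0
  · obtain ⟨n, hn⟩ := h0
    refine ⟨1, h, Or.inr ⟨rfl, fun m => ?_⟩⟩
    by_contra hm
    have := h _ _ hn hm
    omega
  · push Not at h0
    exact ⟨0, h, Or.inl ⟨rfl, h0⟩⟩

/-- The answers of `LLPO` steer the search along states that are never refuted. -/
theorem exists_queries (p : ℕ → ℕ)
    (h0 : ∀ n, refuted kill (initSeg p n) ([], 0) = false)
    (hchild : ∀ s, (∀ n, refuted kill (initSeg p n) s = false) →
      ∃ b, ∀ n, refuted kill (initSeg p n) (child s b) = false) :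
    ∃ r ∈ ofWords (produce (queryOfWord kill)) p, ∃ x,
      baireRep.seq.IsName r x ∧ x ∈ LLPO.parallelization.dom ∧
      ∀ y ∈ LLPO.parallelization.val x, ∀ q, natRep.seq.IsName q y →
        ∀ m n, refuted kill (initSeg p n) (path q m) = false := by
  obtain ⟨r, hr, hr', -⟩ := exists_mem_produce (g := queryOfWord kill) (p := p) (by
    intro m N
    refine ⟨max N (m + 1), le_max_left _ _, ?_⟩
    have : m < (initSeg p (max N (m + 1))).length := by rw [length_initSeg]; omega
    simp only [queryOfWord, this, decide_true, cond_true, Option.isSome_some])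
  have key : ∀ s : List ℕ × ℕ, ∀ k, r (Nat.pair (Encodable.encode s) k) ≠ 0 ↔
      refuted kill (initSeg p (k.div2 + 1)) (child s k.bodd) = true ∧
      refuted kill (initSeg p k.div2) (child s k.bodd) = false ∧
      refuted kill (initSeg p (k.div2 + 1)) (child s (!k.bodd)) = false := by
    intro s k
    obtain ⟨N, hN⟩ := hr' (Nat.pair (Encodable.encode s) k)
    simp only [queryOfWord, length_initSeg, Nat.unpair_pair, Denumerable.ofNat_encode] at hN
    by_cases h : Nat.pair (Encodable.encode s) k < N
    · simp only [h, decide_true, cond_true, Option.some.injEq] at hN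
      rw [← hN]
      exact query_ne_zero ((Nat.right_le_pair _ _).trans_lt h)
    · simp [h] at hN
  have hlt : ∀ {s a b}, refuted kill (initSeg p a) s = true →
      refuted kill (initSeg p b) s = false → b < a := by
    intro s a b ha hb
    by_contra hab
    rw [refuted_mono (initSeg_prefix p (not_lt.1 hab)) ha] at hb
    cases hb
  -- Two nonzero entries of the same parity record the same first refutation stage. With different
  -- parities, each child would be refuted strictly before the other. Every `i` is the code of a
  -- state.
  have hone : ∀ i j k, r (Nat.pair i j) ≠ 0 → r (Nat.pair i k) ≠ 0 → j = k := by
    intro i j k hj hk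
    rw [← Denumerable.encode_ofNat (α := List ℕ × ℕ) i, key] at hj hk
    obtain ⟨hj1, hj2, hj3⟩ := hj
    obtain ⟨hk1, hk2, hk3⟩ := hk
    by_cases hb : j.bodd = k.bodd
    · rw [hb] at hj1 hj2
      have h1 := hlt hj1 hk2
      have h2 := hlt hk1 hj2
      have h3 : j.div2 = k.div2 := by omega
      rw [← Nat.bit_bodd_div2 j, ← Nat.bit_bodd_div2 k, hb, h3]
    · have hb' : (!k.bodd) = j.bodd := by
        revert hb
        cases j.bodd <;> cases k.bodd <;> simp
      have hb'' : (!j.bodd) = k.bodd := by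
        revert hb
        cases j.bodd <;> cases k.bodd <;> simp
      rw [hb'] at hk3
      rw [hb''] at hj3
      have h1 := hlt hj1 hk3
      have h2 := hlt hk1 hj3
      omega
  refine ⟨r, hr, fun i k => r (Nat.pair i k), fun i => rfl, ?_, ?_⟩
  · choose y hy using fun i =>
      LLPO_val_nonempty (p := fun k => r (Nat.pair i k)) (hone i)
    exact ⟨y, hy⟩
  · intro y hy q hq m
    induction m with
    | zero => exact h0
    | succ m ih =>
      rw [path_succ]
      set s := path q m
      have hq' : q (Nat.pair (Encodable.encode s) 0) = y (Encodable.encode s) := hq _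
      rw [hq']
      -- Answer 0 certifies that the even entries vanish, answer 1 the odd ones: the entries
      -- reserved for the child that the answer selects.
      have hzero : ∀ n, r (Nat.pair (Encodable.encode s)
          (Nat.bit (decide (0 < y (Encodable.encode s))) n)) = 0 := by
        intro n
        rcases (hy (Encodable.encode s)).2 with ⟨h, h'⟩ | ⟨h, h'⟩
        · rw [h]; exact h' n
        · rw [h]; exact h' n
      generalize decide (0 < y (Encodable.encode s)) = b at hzero ⊢
      by_contra hcon
      push Not at hcon
      simp only [ne_eq, Bool.not_eq_false] at hcon
      classical
      -- If the selected child were refuted, its first refutation stage `t + 1` would leave a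
      -- nonzero entry at `Nat.bit b t`, because the sibling is the one that survives.
      have hn := Nat.find_spec hcon
      have hmin := fun k => Nat.find_min hcon (m := k)
      set n := Nat.find hcon
      obtain ⟨t, ht⟩ : ∃ t, n = t + 1 := by
        refine ⟨n - 1, ?_⟩
        rcases Nat.eq_zero_or_pos n with h | h
        · rw [h] at hn; simp [refuted, initSeg] at hn
        · omega
      obtain ⟨b', hb'⟩ := hchild s ih
      have hbb : b' = !b := by
        by_contra h
        have : b' = b := by revert h; cases b <;> cases b' <;> simp
        have h1 := hb' n
        rw [this, hn] at h1
        cases h1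
      refine (key s (Nat.bit b t)).2 ?_ (hzero t)
      rw [Nat.bodd_bit, Nat.div2_bit, ← ht, ← hbb]
      exact ⟨hn, by simpa using hmin t (by omega), hb' _⟩

end Search

/-! ### Search states in a computable metric space -/

theorem inv_two_pow_le (n : ℕ) : (2 : ℝ)⁻¹ ^ n ≤ 1 / ((n : ℝ) + 1) := by
  rw [inv_pow, inv_eq_one_div]
  have h : ((n + 1 : ℕ) : ℝ) ≤ ((2 ^ n : ℕ) : ℝ) := by exact_mod_cast n.lt_two_pow_self
  push_cast at h
  exact one_div_le_one_div_of_le (by positivity) h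

theorem computable_sum_lt {α : Type*} [Primcodable α] {a b c d e f : α → ℕ}
    (ha : Computable a) (hb : Computable b) (hc : Computable c) (hd : Computable d)
    (he : Computable e) (hf : Computable f) :
    Computable fun x => decide (a x * e x + c x * (f x + 1) < b x * e x + d x * (f x + 1)) :=
  computable_lt
    (computable_add (computable_mul ha he) (computable_mul hc (Computable.succ.comp hf)))
    (computable_add (computable_mul hb he) (computable_mul hd (Computable.succ.comp hf)))

namespace ComputableMetric

variable {X : Type*} [MetricSpace X] (C : ComputableMetric X)

/-- Computable tests, exact up to the error `2^{-n}`, for the comparison of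
`d(α_i, α_j) + P / Q` with `P' / Q`. -/
theorem exists_comparisons :
    ∃ lt gt : (ℕ × ℕ × ℕ) × (ℕ × ℕ × ℕ) → Bool, Computable lt ∧ Computable gt ∧
      ∀ i j n P P' Q : ℕ, 0 < Q →
        (lt ((i, j, n), (P, P', Q)) = true →
          dist (C.α i) (C.α j) + (P : ℝ) / Q < (P' : ℝ) / Q + (2 : ℝ)⁻¹ ^ n) ∧
        (dist (C.α i) (C.α j) + (P : ℝ) / Q + (2 : ℝ)⁻¹ ^ n < (P' : ℝ) / Q →
          lt ((i, j, n), (P, P', Q)) = true) ∧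
        (gt ((i, j, n), (P, P', Q)) = true →
          (P' : ℝ) / Q < dist (C.α i) (C.α j) + (P : ℝ) / Q + (2 : ℝ)⁻¹ ^ n) ∧
        ((P' : ℝ) / Q + (2 : ℝ)⁻¹ ^ n < dist (C.α i) (C.α j) + (P : ℝ) / Q →
          gt ((i, j, n), (P, P', Q)) = true) := by
  obtain ⟨a, b, c, ha, hb, hc, h⟩ := C.computable_dist
  have h1 : Computable fun y : (ℕ × ℕ × ℕ) × (ℕ × ℕ × ℕ) => y.2.1 :=
    Computable.fst.comp Computable.snd
  have h2 : Computable fun y : (ℕ × ℕ × ℕ) × (ℕ × ℕ × ℕ) => y.2.2.1 :=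
    Computable.fst.comp (Computable.snd.comp Computable.snd)
  have h3 : Computable fun y : (ℕ × ℕ × ℕ) × (ℕ × ℕ × ℕ) => y.2.2.2 :=
    Computable.snd.comp (Computable.snd.comp Computable.snd)
  refine ⟨fun y => decide (a y.1 * y.2.2.2 + y.2.1 * (c y.1 + 1) <
      b y.1 * y.2.2.2 + y.2.2.1 * (c y.1 + 1)),
    fun y => decide (b y.1 * y.2.2.2 + y.2.2.1 * (c y.1 + 1) <
      a y.1 * y.2.2.2 + y.2.1 * (c y.1 + 1)),
    computable_sum_lt (ha.comp Computable.fst) (hb.comp Computable.fst) h1 h2 h3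
      (hc.comp Computable.fst),
    computable_sum_lt (hb.comp Computable.fst) (ha.comp Computable.fst) h2 h1 h3
      (hc.comp Computable.fst), fun i j n P P' Q hQ => ?_⟩
  have hD := abs_le.1 (h i j n)
  set A := a (i, j, n)
  set B := b (i, j, n)
  set D := c (i, j, n)
  have hQ' : (0 : ℝ) < Q := by exact_mod_cast hQ
  have hD' : (0 : ℝ) < (D : ℝ) + 1 := by positivity
  -- Over the common denominator `(D + 1) * Q`, the comparison of rationals becomes one of natural
  -- numbers without subtraction.
  have e1 : ((A : ℝ) - B) / (D + 1) + (P : ℝ) / Q - (P' : ℝ) / Q =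
      ((A * Q + P * (D + 1)) - (B * Q + P' * (D + 1))) / ((D + 1) * Q) := by
    field_simp
    ring
  have hlt : A * Q + P * (D + 1) < B * Q + P' * (D + 1) ↔
      ((A : ℝ) - B) / (D + 1) + (P : ℝ) / Q < (P' : ℝ) / Q := by
    rw [← sub_neg (b := (P' : ℝ) / Q), e1, div_lt_iff₀ (by positivity), zero_mul, sub_neg]
    exact_mod_cast Iff.rfl
  have hgt : B * Q + P' * (D + 1) < A * Q + P * (D + 1) ↔
      (P' : ℝ) / Q < ((A : ℝ) - B) / (D + 1) + (P : ℝ) / Q := by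
    rw [← sub_pos (b := (P' : ℝ) / Q), e1, lt_div_iff₀ (by positivity), zero_mul, sub_pos]
    exact_mod_cast Iff.rfl
  simp only [decide_eq_true_eq]
  rw [hlt, hgt]
  refine ⟨fun h => ?_, fun h => ?_, fun h => ?_, fun h => ?_⟩ <;> linarith [hD.1, hD.2]

/-- The closed set of points compatible with the search state `(l, c)`: those that are
`2^{-(j+1)}`-close to `α_{l_j}` for all `j`, and not `2^{-(|l|+1)}`-close to any `α_a`, `a < c`. -/
def stateSet (s : List ℕ × ℕ) : Set X :=
  {x | (∀ j e, s.1[j]? = some e → dist x (C.α e) ≤ (2 : ℝ)⁻¹ ^ (j + 1)) ∧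
    ∀ a < s.2, (2 : ℝ)⁻¹ ^ (s.1.length + 1) ≤ dist x (C.α a)}

theorem isClosed_stateSet (s : List ℕ × ℕ) : IsClosed (C.stateSet s) := by
  have h : C.stateSet s = (⋂ j, ⋂ e, ⋂ (_ : s.1[j]? = some e),
      {x | dist x (C.α e) ≤ (2 : ℝ)⁻¹ ^ (j + 1)}) ∩
      ⋂ a, ⋂ (_ : a < s.2), {x | (2 : ℝ)⁻¹ ^ (s.1.length + 1) ≤ dist x (C.α a)} := by
    ext x; simp [stateSet]
  rw [h]
  refine IsClosed.inter (isClosed_iInter fun j => isClosed_iInter fun e => isClosed_iInter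
    fun _ => isClosed_le (by fun_prop) (by fun_prop))
    (isClosed_iInter fun a => isClosed_iInter fun _ => isClosed_le (by fun_prop) (by fun_prop))

/-- Either `x` is within `2^{-(|l|+1)}` of the candidate, or it is at least that far from it. Both
conditions are closed and they overlap on equality, so no exact comparison of reals is ever needed.
-/
theorem stateSet_child {s : List ℕ × ℕ} {x : X} (h : x ∈ C.stateSet s) :
    ∃ b, x ∈ C.stateSet (child s b) := by
  by_cases hx : dist x (C.α s.2) ≤ (2 : ℝ)⁻¹ ^ (s.1.length + 1)
  · refine ⟨false, fun j e hj => ?_, fun a ha => absurd ha (Nat.not_lt_zero a)⟩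
    simp only [child, cond_false] at hj
    rcases lt_or_ge j s.1.length with hj' | hj'
    · rw [List.getElem?_append_left hj'] at hj
      exact h.1 j e hj
    · rw [List.getElem?_append_right hj', List.getElem?_singleton] at hj
      split_ifs at hj with h0
      have : j = s.1.length := by omega
      rw [this, ← Option.some_injective _ hj]
      exact hx
  · refine ⟨true, h.1, fun a ha => ?_⟩
    simp only [child, cond_true] at ha ⊢
    rcases Nat.lt_succ_iff_lt_or_eq.1 ha with ha | rfl
    · exact h.2 a ha
    · exact (not_le.1 hx).le

/-- Of the two radii in each hypothesis, one accounts for the position of `x` in the ball. The other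
absorbs the error `2^{-n}` of the test, as the radius is at least `1 / (n + 1)` for `n = t.2.2`. -/
theorem ratBall_disjoint_or_subset {t : ℕ × ℕ × ℕ} {x : X} (hx : x ∈ C.ratBall t) (e : ℕ) {r : ℝ} :
    (r + 2 * (((t.2.1 : ℝ) + 1) / ((t.2.2 : ℝ) + 1)) <
      dist (C.α t.1) (C.α e) + (2 : ℝ)⁻¹ ^ t.2.2 → r < dist x (C.α e)) ∧
    (dist (C.α t.1) (C.α e) + 2 * (((t.2.1 : ℝ) + 1) / ((t.2.2 : ℝ) + 1)) <
      r + (2 : ℝ)⁻¹ ^ t.2.2 → dist x (C.α e) < r) := by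
  have h1 : (2 : ℝ)⁻¹ ^ t.2.2 ≤ ((t.2.1 : ℝ) + 1) / ((t.2.2 : ℝ) + 1) :=
    (inv_two_pow_le _).trans (by gcongr; simp)
  have h2 : dist x (C.α t.1) < ((t.2.1 : ℝ) + 1) / ((t.2.2 : ℝ) + 1) := hx
  have h3 := dist_triangle_left (C.α t.1) (C.α e) x
  have h4 := dist_triangle x (C.α t.1) (C.α e)
  constructor <;> intro h <;> linarith

theorem exists_small_ratBall (x : X) {ε : ℝ} (hε : 0 < ε) :
    ∃ k n : ℕ, x ∈ C.ratBall (k, 0, n) ∧ dist x (C.α k) < 1 / ((n : ℝ) + 1) ∧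
      1 / ((n : ℝ) + 1) < ε := by
  obtain ⟨n, hn⟩ := exists_nat_one_div_lt hε
  obtain ⟨k, hk⟩ := C.dense.exists_dist_lt x (ε := 1 / ((n : ℝ) + 1)) (by positivity)
  exact ⟨k, n, by simpa [ratBall] using hk, hk, hn⟩

theorem exists_cover_of_forall {K : Set X} (hK : IsCompact K) {R : ℕ × ℕ × ℕ → Prop}
    (h : ∀ x ∈ K, ∃ t, x ∈ C.ratBall t ∧ R t) : ∃ w, C.IsCover w K ∧ ∀ t ∈ w, R t := by
  classical
  choose! t ht using h
  obtain ⟨s, hs, hcov⟩ := hK.elim_nhds_subcover (fun y => C.ratBall (t y))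
    (fun y hy => Metric.isOpen_ball.mem_nhds (ht y hy).1)
  refine ⟨s.toList.map t, fun x hx => ?_, ?_⟩
  · obtain ⟨y, hy, hxy⟩ := Set.mem_iUnion₂.1 (hcov hx)
    exact Set.mem_iUnion₂.2 ⟨t y, List.mem_map.2 ⟨y, by simpa using hy, rfl⟩, hxy⟩
  · intro u hu
    obtain ⟨y, hy, rfl⟩ := List.mem_map.1 hu
    exact (ht y (hs y (by simpa using hy))).2

/-- A computable test whether a rational ball is formally disjoint from `stateSet s`. -/
theorem exists_avoid : ∃ R : (ℕ × ℕ × ℕ) × (List ℕ × ℕ) → Bool, Computable R ∧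
    (∀ t s x, R (t, s) = true → x ∈ C.ratBall t → x ∉ C.stateSet s) ∧
    ∀ s x, x ∉ C.stateSet s → ∃ t, x ∈ C.ratBall t ∧ R (t, s) = true := by
  obtain ⟨lt, gt, hlt, hgt, h⟩ := C.exists_comparisons
  -- `Q` is a common denominator: twice the radius of the ball is `A / Q`, and `2^{-(j+1)}` is
  -- `(t.2.2 + 1) / Q`.
  let Q : (ℕ × ℕ × ℕ) → ℕ → ℕ := fun t j => 2 ^ (j + 1) * (t.2.2 + 1)
  let A : (ℕ × ℕ × ℕ) → ℕ → ℕ := fun t j => 2 * (t.2.1 + 1) * 2 ^ (j + 1)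
  let far : (ℕ × ℕ × ℕ) → ℕ → ℕ → Bool := fun t e j =>
    gt ((t.1, e, t.2.2), (0, t.2.2 + 1 + A t j, Q t j))
  let near : (ℕ × ℕ × ℕ) → ℕ → ℕ → Bool := fun t e j =>
    lt ((t.1, e, t.2.2), (A t j, t.2.2 + 1, Q t j))
  let R : (ℕ × ℕ × ℕ) × (List ℕ × ℕ) → Bool := fun y =>
    ((List.range y.2.1.length).any fun j => far y.1 (y.2.1[j]?.getD 0) j) ||
      (List.range y.2.2).any fun e => near y.1 e y.2.1.length
  have hQpos : ∀ t j, 0 < Q t j := fun t j => by positivity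
  have eA : ∀ t j, (A t j : ℝ) / (Q t j : ℝ) =
      2 * (((t.2.1 : ℝ) + 1) / ((t.2.2 : ℝ) + 1)) := by
    intro t j
    simp only [A, Q]
    push_cast
    field_simp
  have eB : ∀ t j, ((t.2.2 + 1 : ℕ) : ℝ) / (Q t j : ℝ) = (2 : ℝ)⁻¹ ^ (j + 1) := by
    intro t j
    simp only [Q]
    push_cast
    rw [inv_pow]
    field_simp
  have eC : ∀ t j, ((t.2.2 + 1 + A t j : ℕ) : ℝ) / (Q t j : ℝ) =
      (2 : ℝ)⁻¹ ^ (j + 1) + 2 * (((t.2.1 : ℝ) + 1) / ((t.2.2 : ℝ) + 1)) := by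
    intro t j
    rw [Nat.cast_add, add_div, eA, eB]
  have hfar : ∀ t e j, (far t e j = true → (2 : ℝ)⁻¹ ^ (j + 1) +
        2 * (((t.2.1 : ℝ) + 1) / ((t.2.2 : ℝ) + 1)) <
        dist (C.α t.1) (C.α e) + (2 : ℝ)⁻¹ ^ t.2.2) ∧
      ((2 : ℝ)⁻¹ ^ (j + 1) + 2 * (((t.2.1 : ℝ) + 1) / ((t.2.2 : ℝ) + 1)) +
        (2 : ℝ)⁻¹ ^ t.2.2 < dist (C.α t.1) (C.α e) → far t e j = true) := by
    intro t e j
    have := (h t.1 e t.2.2 0 (t.2.2 + 1 + A t j) (Q t j) (hQpos t j)).2.2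
    rw [eC, Nat.cast_zero, zero_div, add_zero] at this
    exact this
  have hnear : ∀ t e j, (near t e j = true → dist (C.α t.1) (C.α e) +
        2 * (((t.2.1 : ℝ) + 1) / ((t.2.2 : ℝ) + 1)) < (2 : ℝ)⁻¹ ^ (j + 1) +
        (2 : ℝ)⁻¹ ^ t.2.2) ∧
      (dist (C.α t.1) (C.α e) + 2 * (((t.2.1 : ℝ) + 1) / ((t.2.2 : ℝ) + 1)) +
        (2 : ℝ)⁻¹ ^ t.2.2 < (2 : ℝ)⁻¹ ^ (j + 1) → near t e j = true) := by
    intro t e j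
    have := h t.1 e t.2.2 (A t j) (t.2.2 + 1) (Q t j) (hQpos t j)
    rw [eA, eB] at this
    exact ⟨this.1, this.2.1⟩
  refine ⟨R, ?_, ?_, ?_⟩
  · have hQ : ∀ {γ : Type} [Primcodable γ] {t : γ → ℕ × ℕ × ℕ} {j : γ → ℕ}, Computable t →
        Computable j → Computable fun y => Q (t y) (j y) := fun ht hj =>
      computable_mul (computable_two_pow (Computable.succ.comp hj))
        (Computable.succ.comp (Computable.snd.comp (Computable.snd.comp ht)))
    have hA : ∀ {γ : Type} [Primcodable γ] {t : γ → ℕ × ℕ × ℕ} {j : γ → ℕ}, Computable t →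
        Computable j → Computable fun y => A (t y) (j y) := fun ht hj =>
      computable_mul (computable_mul (Computable.const 2)
        (Computable.succ.comp (Computable.fst.comp (Computable.snd.comp ht))))
        (computable_two_pow (Computable.succ.comp hj))
    have hM : ∀ {γ : Type} [Primcodable γ] {t : γ → ℕ × ℕ × ℕ}, Computable t →
        Computable fun y => (t y).2.2 + 1 := fun ht =>
      Computable.succ.comp (Computable.snd.comp (Computable.snd.comp ht))
    have hT : ∀ {γ : Type} [Primcodable γ] {t : γ → ℕ × ℕ × ℕ} {e : γ → ℕ}, Computable t →
        Computable e → Computable fun y => ((t y).1, e y, (t y).2.2) := fun ht he =>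
      Computable.pair (Computable.fst.comp ht)
        (Computable.pair he (Computable.snd.comp (Computable.snd.comp ht)))
    refine computable_or
      (computable_list_any (p := fun z : ((ℕ × ℕ × ℕ) × (List ℕ × ℕ)) × ℕ =>
        far z.1.1 (z.1.2.1[z.2]?.getD 0) z.2) ?_ ?_)
      (computable_list_any (p := fun z : ((ℕ × ℕ × ℕ) × (List ℕ × ℕ)) × ℕ =>
        near z.1.1 z.2 z.1.2.1.length) ?_ ?_)
    · exact computable_range (Computable.list_length.comp (Computable.fst.comp Computable.snd))
    · have ht : Computable fun z : ((ℕ × ℕ × ℕ) × (List ℕ × ℕ)) × ℕ => z.1.1 :=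
        Computable.fst.comp Computable.fst
      refine hgt.comp (Computable.pair (hT ht (Computable.option_getD (computable_getElem?
        (Computable.fst.comp (Computable.snd.comp Computable.fst)) Computable.snd)
        (Computable.const 0))) (Computable.pair (Computable.const 0) (Computable.pair
        (computable_add (hM ht) (hA ht Computable.snd)) (hQ ht Computable.snd))))
    · exact computable_range (Computable.snd.comp Computable.snd)
    · have ht : Computable fun z : ((ℕ × ℕ × ℕ) × (List ℕ × ℕ)) × ℕ => z.1.1 :=
        Computable.fst.comp Computable.fst
      have hl : Computable fun z : ((ℕ × ℕ × ℕ) × (List ℕ × ℕ)) × ℕ => z.1.2.1.length :=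
        Computable.list_length.comp (Computable.fst.comp (Computable.snd.comp Computable.fst))
      exact hlt.comp (Computable.pair (hT ht Computable.snd)
        (Computable.pair (hA ht hl) (Computable.pair (hM ht) (hQ ht hl))))
  · intro t s x hR hx hs
    simp only [R, Bool.or_eq_true, List.any_eq_true, List.mem_range] at hR
    rcases hR with ⟨j, hj, hR⟩ | ⟨e, he, hR⟩
    · rw [List.getElem?_eq_getElem hj, Option.getD_some] at hR
      have h1 := (C.ratBall_disjoint_or_subset hx _).1 ((hfar _ _ _).1 hR)
      exact absurd (hs.1 j _ (List.getElem?_eq_getElem hj)) (not_le.2 h1)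
    · have h1 := (C.ratBall_disjoint_or_subset hx _).2 ((hnear _ _ _).1 hR)
      exact absurd (hs.2 e he) (not_le.2 h1)
  · intro s x hx
    simp only [stateSet, Set.mem_ofPred_eq, not_and_or] at hx
    push Not at hx
    rcases hx with ⟨j, e, hj, hx⟩ | ⟨e, he, hx⟩
    · obtain ⟨k, n, hk, hkd, hn⟩ := C.exists_small_ratBall x
        -- With radius `1 / (n + 1)`, the test costs two radii, moving from `x` to the centre costs
        -- one, and the comparison error `2^{-n}` costs at most one more: four in all.
        (ε := (dist x (C.α e) - (2 : ℝ)⁻¹ ^ (j + 1)) / 4) (by linarith)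
      refine ⟨_, hk, ?_⟩
      simp only [R, Bool.or_eq_true, List.any_eq_true, List.mem_range]
      refine Or.inl ⟨j, (List.getElem?_eq_some_iff.1 hj).1, (hfar _ _ _).2 ?_⟩
      have h1 := inv_two_pow_le n
      have h2 := dist_triangle x (C.α k) (C.α e)
      rw [hj, Option.getD_some]
      simp only [Nat.cast_zero, zero_add]
      linarith
    · obtain ⟨k, n, hk, hkd, hn⟩ := C.exists_small_ratBall x
        (ε := ((2 : ℝ)⁻¹ ^ (s.1.length + 1) - dist x (C.α e)) / 4) (by linarith)
      refine ⟨_, hk, ?_⟩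
      simp only [R, Bool.or_eq_true, List.any_eq_true, List.mem_range]
      refine Or.inr ⟨e, he, (hnear _ _ _).2 ?_⟩
      have h1 := inv_two_pow_le n
      have h2 := dist_triangle_left (C.α k) (C.α e) x
      simp only [Nat.cast_zero, zero_add]
      linarith

/-- A listed cover refutes `s` if all its balls formally avoid `stateSet s`. By compactness such a
cover exists as soon as `K` misses the set, and a name of `K` lists it; conversely a point of the
intersection lies in some ball of every cover. -/
theorem exists_kill : ∃ kill : ℕ × (List ℕ × ℕ) → Bool, Computable kill ∧
    ∀ p (K : TopologicalSpace.Compacts X), C.compactRep.IsName p K → ∀ s,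
      (∀ n, refuted kill (initSeg p n) s = false) ↔ ((K : Set X) ∩ C.stateSet s).Nonempty := by
  obtain ⟨R, hR, hsound, hcompl⟩ := C.exists_avoid
  refine ⟨fun y => (Denumerable.ofNat (List (ℕ × ℕ × ℕ)) y.1).all fun t => R (t, y.2),
    computable_list_all (p := fun z : (ℕ × (List ℕ × ℕ)) × (ℕ × ℕ × ℕ) => R (z.2, z.1.2))
      ((Computable.ofNat _).comp Computable.fst)
      (hR.comp (Computable.pair Computable.snd (Computable.snd.comp Computable.fst))),
    fun p K hp s => ?_⟩
  have hp' : Set.range p = Encodable.encode '' {w | C.IsCover w (K : Set X)} := hp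
  constructor
  · intro h
    by_contra hne
    obtain ⟨w, hw, hwR⟩ := C.exists_cover_of_forall (R := fun t => R (t, s) = true) K.isCompact
      (fun x hx => hcompl s x fun hxs => hne ⟨x, hx, hxs⟩)
    obtain ⟨n, hn⟩ : Encodable.encode w ∈ Set.range p := hp' ▸ ⟨w, hw, rfl⟩
    have h1 := h (n + 1)
    rw [refuted, List.any_eq_false] at h1
    refine h1 (p n) (List.mem_iff_getElem?.2 ⟨n, getElem?_initSeg p (Nat.lt_succ_self n)⟩) ?_
    rw [hn, Denumerable.ofNat_encode, List.all_eq_true]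
    exact hwR
  · rintro ⟨x, hxK, hxs⟩ n
    rw [refuted, List.any_eq_false]
    intro m hm hall
    obtain ⟨k, hk⟩ := List.mem_iff_getElem?.1 hm
    obtain ⟨w, hw, hwm⟩ : m ∈ Encodable.encode '' {w | C.IsCover w (K : Set X)} :=
      hp' ▸ ⟨k, (getElem?_initSeg_eq_some.1 hk).2⟩
    rw [← hwm, Denumerable.ofNat_encode, List.all_eq_true] at hall
    obtain ⟨t, ht, hxt⟩ := Set.mem_iUnion₂.1 (hw hxK)
    exact hsound t s x (hall t ht) hxt hxs

/-- If no further choice were made after `m` of them, the candidate would increase forever. But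
finitely many balls of radius `2^{-(m+1)}` around dense points cover `K`, so no point of `K` would
remain compatible with the state. -/
theorem exists_lt_length_path {K : Set X} (hK : IsCompact K) {q : ℕ → ℕ}
    (h : ∀ n, (K ∩ C.stateSet (path q n)).Nonempty) (m : ℕ) : ∃ n, m < (path q n).1.length := by
  have key : ∀ m, ∃ n, m ≤ (path q n).1.length := by
    intro m
    induction m with
    | zero => exact ⟨0, Nat.zero_le _⟩
    | succ m ih =>
      obtain ⟨N, hN⟩ := ih
      by_contra hcon
      push Not at hcon
      have hlen : ∀ k, (path q (N + k)).1.length = m := fun k => le_antisymm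
        (Nat.lt_succ_iff.1 (hcon _)) (hN.trans (path_prefix q (Nat.le_add_right N k)).length_le)
      have hsnd : ∀ k, k ≤ (path q (N + k)).2 := by
        intro k
        induction k with
        | zero => exact Nat.zero_le _
        | succ k ih =>
          have h1 := hlen (k + 1)
          rw [← add_assoc, path_succ] at h1 ⊢
          cases hb : decide (0 < q (Nat.pair (Encodable.encode (path q (N + k))) 0)) with
          | false => rw [hb] at h1; simp [child, hlen k] at h1
          | true => simpa [child] using ih
      obtain ⟨c, hc⟩ := hK.elim_directed_cover
        (fun c : ℕ => ⋃ a, ⋃ (_ : a < c), Metric.ball (C.α a) ((2 : ℝ)⁻¹ ^ (m + 1)))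
        (fun c => isOpen_iUnion fun a => isOpen_iUnion fun _ => Metric.isOpen_ball)
        (fun x _ => by
          obtain ⟨a, ha⟩ := C.dense.exists_dist_lt x (ε := (2 : ℝ)⁻¹ ^ (m + 1)) (by positivity)
          exact Set.mem_iUnion.2 ⟨a + 1, Set.mem_iUnion₂.2 ⟨a, Nat.lt_succ_self a, ha⟩⟩)
        (Monotone.directed_le fun c d hcd => Set.iUnion_mono fun a =>
          Set.iUnion_mono' fun ha => ⟨ha.trans_le hcd, le_rfl⟩)
      obtain ⟨x, hxK, hx⟩ := h (N + c)
      obtain ⟨a, ha, hxa⟩ := Set.mem_iUnion₂.1 (hc hxK)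
      have h1 := hx.2 a (lt_of_lt_of_le ha (hsnd c))
      rw [hlen] at h1
      exact absurd h1 (not_le.2 hxa)
  obtain ⟨n, hn⟩ := key (m + 1)
  exact ⟨n, hn⟩

/-- The constraint on rejected candidates is dropped by setting the second component to 0: it
changes whenever a candidate is accepted, while the remaining sets are nested compact sets, and
Cantor's intersection theorem applies. -/
theorem exists_mem_forall_dist_le {K : Set X} (hK : IsCompact K) {q : ℕ → ℕ}
    (h : ∀ n, (K ∩ C.stateSet (path q n)).Nonempty) :
    ∃ x ∈ K, ∀ n j e, (path q n).1[j]? = some e → dist x (C.α e) ≤ (2 : ℝ)⁻¹ ^ (j + 1) := by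
  have hcl : ∀ n, IsClosed (K ∩ C.stateSet ((path q n).1, 0)) :=
    fun n => hK.isClosed.inter (C.isClosed_stateSet _)
  obtain ⟨x, hx⟩ := IsCompact.nonempty_iInter_of_sequence_nonempty_isCompact_isClosed
    (fun n => K ∩ C.stateSet ((path q n).1, 0))
    (fun n x hx => ⟨hx.1, fun j e hj => hx.2.1 j e (getElem?_of_prefix
      (path_prefix q n.le_succ) hj), fun a ha => absurd ha (Nat.not_lt_zero a)⟩)
    (fun n => by
      obtain ⟨x, hxK, hx⟩ := h n
      exact ⟨x, hxK, hx.1, fun a ha => absurd ha (Nat.not_lt_zero a)⟩)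
    (hK.inter_right (C.isClosed_stateSet _)) hcl
  have hx' := Set.mem_iInter.1 hx
  exact ⟨x, (hx' 0).1, fun n => (hx' n).2.1⟩

theorem cauchyRep_isName_of_dist_le {r : ℕ → ℕ} {x : X}
    (h : ∀ j, dist x (C.α (r j)) ≤ (2 : ℝ)⁻¹ ^ (j + 1)) : C.cauchyRep.IsName r x := by
  refine ⟨fun i j hij => ?_, ?_⟩
  · have h3 : (2 : ℝ)⁻¹ ^ (j + 1) ≤ (2 : ℝ)⁻¹ ^ (i + 1) :=
      pow_le_pow_of_le_one (by norm_num) (by norm_num) (by omega)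
    have h4 : (2 : ℝ)⁻¹ ^ (i + 1) = (2 : ℝ)⁻¹ ^ i * 2⁻¹ := pow_succ _ _
    have h5 := dist_triangle_left (C.α (r i)) (C.α (r j)) x
    linarith [h i, h j]
  · rw [tendsto_iff_dist_tendsto_zero]
    have hlim : Filter.Tendsto (fun i : ℕ => (2 : ℝ)⁻¹ ^ (i + 1)) Filter.atTop (nhds 0) :=
      (tendsto_pow_atTop_nhds_zero_of_lt_one (by norm_num) (by norm_num)).comp
        (Filter.tendsto_add_atTop_nat 1)
    exact squeeze_zero (fun _ => dist_nonneg) (fun i => by rw [dist_comm]; exact h i) hlim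

theorem compactChoice_reducible : StrongReducible C.compactChoice LLPO.parallelization := by
  obtain ⟨kill, hkill, hspec⟩ := C.exists_kill
  refine ⟨ofWords (produce choiceOfWord), ofWords (produce (queryOfWord kill)),
    computableFun_produce computable_choiceOfWord,
    computableFun_produce (computable_queryOfWord hkill), fun G hG p K hp hK => ?_⟩
  have hK' : (K : Set X).Nonempty := hK
  have hs := hspec p K hp
  -- The initial state imposes no condition, so it survives because `K` is nonempty.
  obtain ⟨r, hr, x, hrx, hx, hy⟩ := exists_queries (kill := kill) p
    ((hs _).2 (hK'.mono fun x hx => ⟨hx, by simp [stateSet]⟩))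
    (fun s h => by
      obtain ⟨x, hxK, hx⟩ := (hs s).1 h
      obtain ⟨b, hb⟩ := C.stateSet_child hx
      exact ⟨b, (hs _).2 ⟨x, hxK, hb⟩⟩)
  obtain ⟨q, hq, y, hyx, hqy⟩ := hG r x hrx hx
  have halive : ∀ n, ((K : Set X) ∩ C.stateSet (path q n)).Nonempty :=
    fun n => (hs _).1 (hy y hyx q hqy n)
  have hlen := C.exists_lt_length_path K.isCompact halive
  obtain ⟨z, hz, hzr⟩ := exists_mem_produce_choiceOfWord hlen
  obtain ⟨u, hu, hdist⟩ := C.exists_mem_forall_dist_le K.isCompact halive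
  refine ⟨z, ?_, u, hu, C.cauchyRep_isName_of_dist_le fun j => ?_⟩
  · exact Part.mem_bind_iff.2 ⟨q, Part.mem_bind_iff.2 ⟨r, hr, hq⟩, hz⟩
  · obtain ⟨n, hn⟩ := hlen j
    have h1 := List.getElem?_eq_getElem hn
    rw [hzr n j _ h1]
    exact hdist n j _ h1

end ComputableMetric

/-! ### Binary words and the fan theorem -/

section Binary

/-- The name of a point of Cantor space. -/
def bits (b : ℕ → Bool) : ℕ → ℕ := fun i => (b i).toNat

theorem initSeg_succ (p : ℕ → ℕ) (n : ℕ) : initSeg p (n + 1) = initSeg p n ++ [p n] := by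
  simp [initSeg, List.range_succ]

theorem initSeg_congr {p q : ℕ → ℕ} {n : ℕ} (h : ∀ i < n, p i = q i) :
    initSeg p n = initSeg q n :=
  List.map_congr_left fun i hi => h i (List.mem_range.1 hi)

/-- The list of all binary words of length `n`. -/
def binaryWords (n : ℕ) : List (List ℕ) :=
  Nat.rec [[]] (fun _ L => L.map (fun v => v ++ [0]) ++ L.map fun v => v ++ [1]) n

theorem computable_binaryWords : Computable binaryWords := by
  have h : Computable₂ fun (_ : ℕ) (y : ℕ × List (List ℕ)) =>
      y.2.map (fun v => v ++ [0]) ++ y.2.map fun v => v ++ [1] := ?_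
  · exact Computable.nat_rec Computable.id (Computable.const [[]]) h
  have hm : ∀ c : ℕ, Computable fun L : List (List ℕ) => L.map fun v => v ++ [c] := fun c =>
    (Primrec.list_map Primrec.id
      ((Primrec.list_concat.comp Primrec.snd (Primrec.const c)).to₂ :
        Primrec₂ fun (_ : List (List ℕ)) (v : List ℕ) => v ++ [c])).to_comp
  exact Computable.list_append.comp ((hm 0).comp (Computable.snd.comp Computable.snd))
    ((hm 1).comp (Computable.snd.comp Computable.snd))

theorem mem_binaryWords {n : ℕ} {v : List ℕ} :
    v ∈ binaryWords n ↔ ∃ b, v = initSeg (bits b) n := by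
  induction n generalizing v with
  | zero => simp [binaryWords, initSeg]
  | succ n ih =>
    have h : v ∈ binaryWords (n + 1) ↔ ∃ c : Bool, ∃ u ∈ binaryWords n, u ++ [c.toNat] = v := by
      simp [binaryWords]
    rw [h]
    constructor
    · rintro ⟨c, u, hu, rfl⟩
      obtain ⟨b, rfl⟩ := ih.1 hu
      refine ⟨Function.update b n c, ?_⟩
      rw [initSeg_succ]
      congr 1
      · exact initSeg_congr fun i hi => by simp [bits, Function.update_of_ne hi.ne]
      · simp [bits]
    · rintro ⟨b, rfl⟩
      exact ⟨b n, _, ih.2 ⟨b, rfl⟩, (initSeg_succ _ _).symm⟩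

theorem eventually_agree (b : ℕ → Bool) (n : ℕ) : ∀ᶠ b' in nhds b, ∀ i < n, b' i = b i := by
  have h : ∀ i ∈ Finset.range n, ∀ᶠ b' : ℕ → Bool in nhds b, b' i = b i := fun i _ =>
    (continuous_apply i).continuousAt.preimage_mem_nhds
      ((isOpen_discrete ({b i} : Set Bool)).mem_nhds rfl)
  filter_upwards [(Filter.eventually_all_finset _).2 h] with b' hb' i hi
  exact hb' i (Finset.mem_range.2 hi)

/-- The fan theorem: a monotone sequence of properties of points of Cantor space, the `n`-th of
which depends on the first `n` bits only, holds uniformly if it holds pointwise. -/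
theorem fan {U : ℕ → (ℕ → Bool) → Prop}
    (hloc : ∀ n b b', (∀ i < n, b i = b' i) → U n b → U n b')
    (hmono : ∀ m n b, m ≤ n → U m b → U n b) (hU : ∀ b, ∃ n, U n b) :
    ∃ N, ∀ n, N ≤ n → ∀ b, U n b := by
  obtain ⟨N, hN⟩ := isCompact_univ.elim_directed_cover (fun n => {b | U n b})
    (fun n => by
      rw [isOpen_iff_mem_nhds]
      intro b hb
      filter_upwards [eventually_agree b n] with b' hb'
      exact hloc n b b' (fun i hi => (hb' i hi).symm) hb)
    (fun b _ => Set.mem_iUnion.2 (hU b))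
    (Monotone.directed_le fun m n hmn b hb => hmono m n b hmn hb)
  exact ⟨N, fun n hn b => hmono N n b hn (hN (Set.mem_univ b))⟩

end Binary

/-! ### Computable maps from Cantor space into a metric space -/

namespace ComputableMetric

variable {X : Type*} [MetricSpace X] (C : ComputableMetric X)

theorem dist_le_of_isName {q : ℕ → ℕ} {x : X} (h : C.cauchyRep.IsName q x) (m : ℕ) :
    dist (C.α (q m)) x ≤ (2 : ℝ)⁻¹ ^ m := by
  refine le_of_tendsto (tendsto_const_nhds.dist h.2) ?_
  filter_upwards [Filter.eventually_ge_atTop m] with j hj using h.1 m j hj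

theorem exists_inv_two_pow_lt {ε : ℝ} (hε : 0 < ε) : ∃ m : ℕ, (2 : ℝ)⁻¹ ^ m < ε :=
  exists_pow_lt_of_lt_one hε (by norm_num)

theorem exists_wordFun {ι : (ℕ → Bool) → X} (h : (ofFun cantorRep C.cauchyRep ι).IsComputable) :
    ∃ (f : List ℕ → List ℕ) (Q : (ℕ → Bool) → ℕ → ℕ), Computable f ∧
      (∀ u v, u <+: v → f u <+: f v) ∧ (∀ b, C.cauchyRep.IsName (Q b) (ι b)) ∧
      (∀ b n m e, (f (initSeg (bits b) n))[m]? = some e → Q b m = e) ∧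
      ∀ b m, ∃ n, (f (initSeg (bits b) n))[m]? = some (Q b m) := by
  obtain ⟨F, ⟨f, hf, hmono, hF⟩, hreal⟩ := h
  have h1 : ∀ b, ∃ q ∈ F (bits b), C.cauchyRep.IsName q (ι b) := fun b => by
    obtain ⟨q, hq, y, hy, hqy⟩ := hreal (bits b) b (fun _ => rfl) ⟨ι b, rfl⟩
    exact ⟨q, hq, hy ▸ hqy⟩
  choose Q hQ hname using h1
  refine ⟨f, Q, hf, hmono, hname, fun b n m e he => ?_, fun b m => ?_⟩
  · rw [(hF _ _ (hQ b)).1 n] at he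
    exact (getElem?_initSeg_eq_some.1 he).2
  · obtain ⟨n, hn⟩ := (hF _ _ (hQ b)).2 (m + 1)
    refine ⟨n, ?_⟩
    rw [(hF _ _ (hQ b)).1 n]
    exact getElem?_initSeg _ hn

/-- A finite prefix of the input fixes the `m`-th approximation, and hence the value up to `2 *
2^{-m}`. -/
theorem continuous_of_isComputable {ι : (ℕ → Bool) → X}
    (h : (ofFun cantorRep C.cauchyRep ι).IsComputable) : Continuous ι := by
  obtain ⟨f, Q, -, -, hname, hQ, hQ'⟩ := C.exists_wordFun h
  rw [continuous_iff_continuousAt]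
  intro b
  rw [ContinuousAt, Metric.tendsto_nhds]
  intro ε hε
  obtain ⟨m, hm⟩ := exists_inv_two_pow_lt (half_pos hε)
  obtain ⟨n, hn⟩ := hQ' b m
  filter_upwards [eventually_agree b n] with b' hb'
  have h1 : initSeg (bits b) n = initSeg (bits b') n := initSeg_congr fun i hi => by
    simp [bits, hb' i hi]
  rw [h1] at hn
  have h2 := C.dist_le_of_isName (hname b) m
  have h3 := C.dist_le_of_isName (hname b') m
  rw [hQ b' n m _ hn] at h3
  have h4 := dist_triangle_left (ι b') (ι b) (C.α (Q b m))
  linarith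

/-- A computable test whether the word `f v` witnesses that `ι` maps the cylinder of `v` into
one of the rational balls in a given list. -/
theorem exists_covered {ι : (ℕ → Bool) → X} {f : List ℕ → List ℕ} {Q : (ℕ → Bool) → ℕ → ℕ}
    (hf : Computable f) (hmono : ∀ u v, u <+: v → f u <+: f v)
    (hname : ∀ b, C.cauchyRep.IsName (Q b) (ι b))
    (hQ : ∀ b n m e, (f (initSeg (bits b) n))[m]? = some e → Q b m = e)
    (hQ' : ∀ b m, ∃ n, (f (initSeg (bits b) n))[m]? = some (Q b m)) :
    ∃ T : List (ℕ × ℕ × ℕ) × List ℕ → Bool, Computable T ∧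
      (∀ w u v, u <+: v → T (w, u) = true → T (w, v) = true) ∧
      ∀ w b, (∃ n, T (w, initSeg (bits b) n) = true) ↔ ∃ t ∈ w, ι b ∈ C.ratBall t := by
  obtain ⟨lt, _, hlt, -, h⟩ := C.exists_comparisons
  -- The margin added to the distance is `2 * 2^{-m}`: one part for the distance from `α e` to `ι
  -- b`, one for the error of the comparison.
  let near : ℕ → ℕ → ℕ × ℕ × ℕ → Bool := fun e m t =>
    lt ((e, t.1, m), (2 * (t.2.2 + 1), (t.2.1 + 1) * 2 ^ m, 2 ^ m * (t.2.2 + 1)))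
  have hnear : ∀ e m t, (near e m t = true → dist (C.α e) (C.α t.1) + 2 * (2 : ℝ)⁻¹ ^ m <
        ((t.2.1 : ℝ) + 1) / ((t.2.2 : ℝ) + 1) + (2 : ℝ)⁻¹ ^ m) ∧
      (dist (C.α e) (C.α t.1) + 2 * (2 : ℝ)⁻¹ ^ m + (2 : ℝ)⁻¹ ^ m <
        ((t.2.1 : ℝ) + 1) / ((t.2.2 : ℝ) + 1) → near e m t = true) := by
    intro e m t
    have h1 := h e t.1 m (2 * (t.2.2 + 1)) ((t.2.1 + 1) * 2 ^ m) (2 ^ m * (t.2.2 + 1))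
      (by positivity)
    have e1 : ((2 * (t.2.2 + 1) : ℕ) : ℝ) / ((2 ^ m * (t.2.2 + 1) : ℕ) : ℝ) =
        2 * (2 : ℝ)⁻¹ ^ m := by
      push_cast
      rw [inv_pow]
      field_simp
    have e2 : (((t.2.1 + 1) * 2 ^ m : ℕ) : ℝ) / ((2 ^ m * (t.2.2 + 1) : ℕ) : ℝ) =
        ((t.2.1 : ℝ) + 1) / ((t.2.2 : ℝ) + 1) := by
      push_cast
      field_simp
    rw [e1, e2] at h1
    exact ⟨h1.1, h1.2.1⟩
  refine ⟨fun y => (List.range (f y.2).length).any fun m =>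
    y.1.any fun t => near ((f y.2)[m]?.getD 0) m t, ?_, ?_, ?_⟩
  · have hfy : Computable fun y : List (ℕ × ℕ × ℕ) × List ℕ => f y.2 := hf.comp Computable.snd
    refine computable_list_any (p := fun z : (List (ℕ × ℕ × ℕ) × List ℕ) × ℕ =>
      z.1.1.any fun t => near ((f z.1.2)[z.2]?.getD 0) z.2 t)
      (computable_range (Computable.list_length.comp hfy)) ?_
    refine computable_list_any (p := fun z : ((List (ℕ × ℕ × ℕ) × List ℕ) × ℕ) × (ℕ × ℕ × ℕ) =>
      near ((f z.1.1.2)[z.1.2]?.getD 0) z.1.2 z.2) (Computable.fst.comp Computable.fst) ?_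
    have hm : Computable fun z : ((List (ℕ × ℕ × ℕ) × List ℕ) × ℕ) × (ℕ × ℕ × ℕ) => z.1.2 :=
      Computable.snd.comp Computable.fst
    have hi : Computable fun z : ((List (ℕ × ℕ × ℕ) × List ℕ) × ℕ) × (ℕ × ℕ × ℕ) =>
        z.2.2.1 + 1 :=
      Computable.succ.comp (Computable.fst.comp (Computable.snd.comp Computable.snd))
    have hj : Computable fun z : ((List (ℕ × ℕ × ℕ) × List ℕ) × ℕ) × (ℕ × ℕ × ℕ) =>
        z.2.2.2 + 1 :=
      Computable.succ.comp (Computable.snd.comp (Computable.snd.comp Computable.snd))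
    exact hlt.comp (Computable.pair
      (Computable.pair (Computable.option_getD (computable_getElem?
        (hfy.comp (Computable.fst.comp Computable.fst)) hm) (Computable.const 0))
        (Computable.pair (Computable.fst.comp Computable.snd) hm))
      (Computable.pair (computable_mul (Computable.const 2) hj)
        (Computable.pair (computable_mul hi (computable_two_pow hm))
          (computable_mul (computable_two_pow hm) hj))))
  · intro w u v huv hu
    simp only [List.any_eq_true, List.mem_range] at hu ⊢
    obtain ⟨m, hm, t, ht, hu⟩ := hu
    refine ⟨m, hm.trans_le (hmono u v huv).length_le, t, ht, ?_⟩
    have h1 := List.getElem?_eq_getElem hm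
    rw [getElem?_of_prefix (hmono u v huv) h1]
    rwa [h1] at hu
  · intro w b
    simp only [List.any_eq_true, List.mem_range]
    constructor
    · rintro ⟨n, m, hm, t, ht, hn⟩
      refine ⟨t, ht, ?_⟩
      have h1 := List.getElem?_eq_getElem hm
      rw [h1, Option.getD_some, ← hQ b n m _ h1] at hn
      have h2 := (hnear _ _ _).1 hn
      have h3 := C.dist_le_of_isName (hname b) m
      have h4 := dist_triangle_left (ι b) (C.α t.1) (C.α (Q b m))
      change dist (ι b) (C.α t.1) < _
      linarith
    · rintro ⟨t, ht, hb⟩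
      have hb' : dist (ι b) (C.α t.1) < ((t.2.1 : ℝ) + 1) / ((t.2.2 : ℝ) + 1) := hb
      -- The margin, the comparison error and the approximation of `ι b` consume `4 * 2^{-m}` of the
      -- gap.
      obtain ⟨m, hm⟩ := exists_inv_two_pow_lt (div_pos (sub_pos.2 hb') (by norm_num : (0 : ℝ) < 5))
      obtain ⟨n, hn⟩ := hQ' b m
      refine ⟨n, m, (List.getElem?_eq_some_iff.1 hn).1, t, ht, ?_⟩
      rw [hn, Option.getD_some]
      refine (hnear _ _ _).2 ?_
      have h3 := C.dist_le_of_isName (hname b) m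
      have h4 := dist_triangle (C.α (Q b m)) (ι b) (C.α t.1)
      linarith

/-- A computable test whether a prefix `u` of a Cauchy name and the word `f v` witness that the
named point is not the image under `ι` of a point in the cylinder of `v`. -/
theorem exists_separated {ι : (ℕ → Bool) → X} {f : List ℕ → List ℕ} {Q : (ℕ → Bool) → ℕ → ℕ}
    (hf : Computable f) (hmono : ∀ u v, u <+: v → f u <+: f v)
    (hname : ∀ b, C.cauchyRep.IsName (Q b) (ι b))
    (hQ : ∀ b n m e, (f (initSeg (bits b) n))[m]? = some e → Q b m = e)
    (hQ' : ∀ b m, ∃ n, (f (initSeg (bits b) n))[m]? = some (Q b m)) :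
    ∃ T : List ℕ × List ℕ → Bool, Computable T ∧
      (∀ u u' v v', u <+: u' → v <+: v' → T (u, v) = true → T (u', v') = true) ∧
      ∀ z x b, C.cauchyRep.IsName z x →
        ((∃ n, T (initSeg z n, initSeg (bits b) n) = true) ↔ x ≠ ι b) := by
  obtain ⟨_, gt, -, hgt, h⟩ := C.exists_comparisons
  -- The threshold `3 * 2^{-m}` allows for the errors of the two approximations and of the
  -- comparison.
  let far : ℕ → ℕ → ℕ → Bool := fun e e' m => gt ((e, e', m), (0, 3, 2 ^ m))
  have hfar : ∀ e e' m, (far e e' m = true →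
        3 * (2 : ℝ)⁻¹ ^ m < dist (C.α e) (C.α e') + (2 : ℝ)⁻¹ ^ m) ∧
      (3 * (2 : ℝ)⁻¹ ^ m + (2 : ℝ)⁻¹ ^ m < dist (C.α e) (C.α e') → far e e' m = true) := by
    intro e e' m
    have h1 := h e e' m 0 3 (2 ^ m) (by positivity)
    have e1 : ((3 : ℕ) : ℝ) / ((2 ^ m : ℕ) : ℝ) = 3 * (2 : ℝ)⁻¹ ^ m := by
      push_cast
      rw [inv_pow, div_eq_mul_inv]
    rw [e1, Nat.cast_zero, zero_div, add_zero] at h1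
    exact h1.2.2
  let T : List ℕ × List ℕ → Bool := fun y => (List.range y.1.length).any fun m =>
    decide (m < (f y.2).length) && far (y.1[m]?.getD 0) ((f y.2)[m]?.getD 0) m
  have hT : ∀ y, T y = true ↔ ∃ m e e', y.1[m]? = some e ∧ (f y.2)[m]? = some e' ∧
      far e e' m = true := by
    intro y
    simp only [T, List.any_eq_true, List.mem_range, Bool.and_eq_true, decide_eq_true_eq]
    constructor
    · rintro ⟨m, hm, hm', hfar⟩
      rw [List.getElem?_eq_getElem hm, List.getElem?_eq_getElem hm'] at hfar
      exact ⟨m, _, _, List.getElem?_eq_getElem hm, List.getElem?_eq_getElem hm', hfar⟩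
    · rintro ⟨m, e, e', he, he', hfar⟩
      refine ⟨m, (List.getElem?_eq_some_iff.1 he).1, (List.getElem?_eq_some_iff.1 he').1, ?_⟩
      rwa [he, he']
  refine ⟨T, ?_, ?_, ?_⟩
  · have hfy : Computable fun y : List ℕ × List ℕ => f y.2 := hf.comp Computable.snd
    refine computable_list_any (p := fun z : (List ℕ × List ℕ) × ℕ =>
      decide (z.2 < (f z.1.2).length) && far (z.1.1[z.2]?.getD 0) ((f z.1.2)[z.2]?.getD 0) z.2)
      (computable_range (Computable.list_length.comp Computable.fst)) ?_
    refine computable_and (computable_lt Computable.snd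
      (Computable.list_length.comp (hfy.comp Computable.fst))) (hgt.comp (Computable.pair
        (Computable.pair ?_ (Computable.pair ?_ Computable.snd)) (Computable.pair
          (Computable.const 0) (Computable.pair (Computable.const 3)
            (computable_two_pow Computable.snd)))))
    · exact Computable.option_getD (computable_getElem? (Computable.fst.comp Computable.fst)
        Computable.snd) (Computable.const 0)
    · exact Computable.option_getD (computable_getElem? (hfy.comp Computable.fst)
        Computable.snd) (Computable.const 0)
  · intro u u' v v' hu hv
    rw [hT, hT]
    rintro ⟨m, e, e', he, he', h1⟩
    exact ⟨m, e, e', getElem?_of_prefix hu he, getElem?_of_prefix (hmono _ _ hv) he', h1⟩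
  · intro z x b hz
    constructor
    · rintro ⟨n, hn⟩ rfl
      obtain ⟨m, e, e', he, he', h1⟩ := (hT _).1 hn
      have h2 := (hfar _ _ _).1 h1
      rw [← hQ b n m e' he', ← (getElem?_initSeg_eq_some.1 he).2] at h2
      have h3 := C.dist_le_of_isName (hname b) m
      have h4 := C.dist_le_of_isName hz m
      have h5 := dist_triangle_right (C.α (z m)) (C.α (Q b m)) (ι b)
      linarith
    · intro hne
      -- The factor 6 is made up of the threshold 3, the comparison error 1 and the two
      -- approximations.
      obtain ⟨m, hm⟩ := exists_inv_two_pow_lt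
        (div_pos (dist_pos.2 hne) (by norm_num : (0 : ℝ) < 6))
      obtain ⟨n, hn⟩ := hQ' b m
      refine ⟨max n (m + 1), (hT _).2 ⟨m, z m, Q b m, getElem?_initSeg z (by omega),
        getElem?_of_prefix (hmono _ _ (initSeg_prefix _ (le_max_left _ _))) hn,
        (hfar _ _ _).2 ?_⟩⟩
      have h3 := C.dist_le_of_isName (hname b) m
      have h4 := C.dist_le_of_isName hz m
      have h5 := dist_triangle4 x (C.α (z m)) (C.α (Q b m)) (ι b)
      rw [dist_comm x (C.α (z m))] at h5
      linarith

end ComputableMetric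

/-! ### Solutions of `LLPO` instances and the translations by finite words -/

/-- Whether the word `v` violates a condition on the answers given by the word `u` of a sequence
of instances of `LLPO`. -/
def violates (u v : List ℕ) : Bool :=
  (List.range u.length).any fun j =>
    -- A nonzero entry at an even position forbids the answer 0, one at an odd position the answer
    -- 1.
    decide (0 < u[j]?.getD 0) && decide (v[j.unpair.1]? = some (j.unpair.2 % 2))

theorem violates_iff {u v : List ℕ} : violates u v = true ↔
    ∃ j c : ℕ, u[j]? = some c ∧ c ≠ 0 ∧ v[j.unpair.1]? = some (j.unpair.2 % 2) := by
  simp only [violates, List.any_eq_true, List.mem_range, Bool.and_eq_true, decide_eq_true_eq]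
  constructor
  · rintro ⟨j, hj, h1, h2⟩
    rw [List.getElem?_eq_getElem hj] at h1
    exact ⟨j, _, List.getElem?_eq_getElem hj, h1.ne', h2⟩
  · rintro ⟨j, c, hj, h1, h2⟩
    exact ⟨j, (List.getElem?_eq_some_iff.1 hj).1, by rw [hj]; exact Nat.pos_of_ne_zero h1, h2⟩

theorem violates_mono {u u' v v' : List ℕ} (hu : u <+: u') (hv : v <+: v')
    (h : violates u v = true) : violates u' v' = true := by
  obtain ⟨j, c, h1, h2, h3⟩ := violates_iff.1 h
  exact violates_iff.2 ⟨j, c, getElem?_of_prefix hu h1, h2, getElem?_of_prefix hv h3⟩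

theorem computable_violates {α : Type*} [Primcodable α] {u v : α → List ℕ} (hu : Computable u)
    (hv : Computable v) : Computable fun a => violates (u a) (v a) := by
  refine computable_list_any (p := fun z : α × ℕ =>
    decide (0 < (u z.1)[z.2]?.getD 0) &&
      decide ((v z.1)[z.2.unpair.1]? = some (z.2.unpair.2 % 2)))
    (computable_range (Computable.list_length.comp hu)) ?_
  have hp := Computable.unpair.comp (Computable.snd (α := α) (β := ℕ))
  refine computable_and (computable_lt (Computable.const 0) ?_) (computable_beq ?_ ?_)
  · exact Computable.option_getD (computable_getElem? (hu.comp Computable.fst)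
      Computable.snd) (Computable.const 0)
  · exact computable_getElem? (hv.comp Computable.fst) (Computable.fst.comp hp)
  · exact Computable.option_some.comp
      (Primrec.nat_mod.to_comp.comp (Computable.snd.comp hp) (Computable.const 2))

/-- The points of Cantor space that are solutions of the sequence of instances of `LLPO` named
by `p`. -/
def solutions (p : ℕ → ℕ) : Set (ℕ → Bool) :=
  {b | ∀ j, p j ≠ 0 → bits b j.unpair.1 ≠ j.unpair.2 % 2}

theorem isClosed_solutions (p : ℕ → ℕ) : IsClosed (solutions p) := by
  have h : solutions p = ⋂ j, (fun b : ℕ → Bool => b j.unpair.1) ⁻¹'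
      {c | p j ≠ 0 → c.toNat ≠ j.unpair.2 % 2} := by
    ext b; simp [solutions, bits]
  rw [h]
  exact isClosed_iInter fun j => (isClosed_discrete _).preimage (continuous_apply _)

theorem exists_violates_iff {p : ℕ → ℕ} {b : ℕ → Bool} :
    (∃ n, violates (initSeg p n) (initSeg (bits b) n) = true) ↔ b ∉ solutions p := by
  simp only [solutions, Set.mem_ofPred_eq, not_forall, ne_eq, not_not]
  constructor
  · rintro ⟨n, hn⟩
    obtain ⟨j, c, h1, h2, h3⟩ := violates_iff.1 hn
    exact ⟨j, (getElem?_initSeg_eq_some.1 h1).2 ▸ h2, (getElem?_initSeg_eq_some.1 h3).2⟩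
  · rintro ⟨j, h1, h2⟩
    refine ⟨max j j.unpair.1 + 1, violates_iff.2
      ⟨j, p j, getElem?_initSeg p (by omega), h1, ?_⟩⟩
    rw [← h2]
    exact getElem?_initSeg _ (by omega)

theorem solutions_nonempty {p : ℕ → ℕ} {x : ℕ → ℕ → ℕ} (hp : baireRep.seq.IsName p x)
    (hx : x ∈ LLPO.parallelization.dom) : (solutions p).Nonempty := by
  obtain ⟨y, hy⟩ := hx
  refine ⟨fun i => decide (y i = 1), fun j hj => ?_⟩
  have hpx : ∀ i k, p (Nat.pair i k) = x i k := fun i k => congrFun (hp i) k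
  rw [← Nat.pair_unpair j, hpx] at hj
  intro h
  rcases (hy j.unpair.1).2 with ⟨h1, h2⟩ | ⟨h1, h2⟩
  · simp only [bits, h1] at h
    apply hj
    rw [show j.unpair.2 = 2 * (j.unpair.2 / 2) by simp at h; omega]
    exact h2 _
  · simp only [bits, h1] at h
    apply hj
    rw [show j.unpair.2 = 2 * (j.unpair.2 / 2) + 1 by simp at h; omega]
    exact h2 _

theorem bits_mem_parallelization {p : ℕ → ℕ} {x : ℕ → ℕ → ℕ} (hp : baireRep.seq.IsName p x)
    (hx : x ∈ LLPO.parallelization.dom) {b : ℕ → Bool} (hb : b ∈ solutions p) :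
    bits b ∈ LLPO.parallelization.val x := by
  obtain ⟨y, hy⟩ := hx
  have hpx : ∀ i k, p (Nat.pair i k) = x i k := fun i k => congrFun (hp i) k
  intro i
  refine ⟨(hy i).1, ?_⟩
  have key : ∀ k, x i k ≠ 0 → bits b i ≠ k % 2 := fun k hk => by
    have := hb (Nat.pair i k) (by rwa [hpx])
    rwa [Nat.unpair_pair] at this
  cases h : b i with
  | false =>
    refine Or.inl ⟨by simp [bits, h], fun n => ?_⟩
    by_contra hn
    exact key _ hn (by simp [bits, h])
  | true =>
    refine Or.inr ⟨by simp [bits, h], fun n => ?_⟩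
    by_contra hn
    exact key _ hn (by simp [bits, h])

/-- The enumeration of all lists of rational balls that are recognized, by means of the
test `T`, as covers of the image of the set of solutions. -/
def coverOfWord (T : List (ℕ × ℕ × ℕ) × List ℕ → Bool) (a : List ℕ × ℕ) : Option ℕ :=
  cond ((binaryWords a.1.length).all fun v => violates a.1 v ||
    T (Denumerable.ofNat _ a.1.length.unpair.1, v)) (some a.1.length.unpair.1) none

theorem computable_coverOfWord {T : List (ℕ × ℕ × ℕ) × List ℕ → Bool} (hT : Computable T) :
    Computable (coverOfWord T) := by
  have hl : Computable fun a : List ℕ × ℕ => a.1.length :=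
    Computable.list_length.comp Computable.fst
  have hw : Computable fun a : List ℕ × ℕ => a.1.length.unpair.1 :=
    Computable.fst.comp (Computable.unpair.comp hl)
  have hd : Computable fun z : (List ℕ × ℕ) × List ℕ =>
      Denumerable.ofNat (List (ℕ × ℕ × ℕ)) z.1.1.length.unpair.1 :=
    (Computable.ofNat _).comp (hw.comp Computable.fst)
  have hv : Computable fun z : (List ℕ × ℕ) × List ℕ => violates z.1.1 z.2 :=
    computable_violates (Computable.fst.comp Computable.fst) Computable.snd
  have hor : Computable fun z : (List ℕ × ℕ) × List ℕ => violates z.1.1 z.2 ||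
      T (Denumerable.ofNat _ z.1.1.length.unpair.1, z.2) :=
    computable_or hv (hT.comp (Computable.pair hd Computable.snd))
  have hall : Computable fun a : List ℕ × ℕ => (binaryWords a.1.length).all fun v =>
      violates a.1 v || T (Denumerable.ofNat _ a.1.length.unpair.1, v) :=
    computable_list_all (computable_binaryWords.comp hl) hor
  exact Computable.cond hall (Computable.option_some.comp hw) (Computable.const none)

theorem coverOfWord_eq_some {T : List (ℕ × ℕ × ℕ) × List ℕ → Bool} {p : ℕ → ℕ} {n m c : ℕ} :
    coverOfWord T (initSeg p n, m) = some c ↔ n.unpair.1 = c ∧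
      ∀ b, violates (initSeg p n) (initSeg (bits b) n) = true ∨
        T (Denumerable.ofNat _ n.unpair.1, initSeg (bits b) n) = true := by
  have h : ((binaryWords n).all fun v => violates (initSeg p n) v ||
      T (Denumerable.ofNat _ n.unpair.1, v)) = true ↔
      ∀ b, violates (initSeg p n) (initSeg (bits b) n) = true ∨
        T (Denumerable.ofNat _ n.unpair.1, initSeg (bits b) n) = true := by
    simp [mem_binaryWords]
  rw [← h, coverOfWord]
  simp only [length_initSeg]
  cases (binaryWords n).all fun v => violates (initSeg p n) v ||
      T (Denumerable.ofNat _ n.unpair.1, v) <;> simp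

/-- The bits of the preimage of a point `x`, recognized from a prefix of a name of `x` by means of
the test `T`. -/
def bitOfWord (T : List ℕ × List ℕ → Bool) (a : List ℕ × ℕ) : Option ℕ :=
  cond ((binaryWords a.1.length).all fun v => decide (v[a.2.unpair.1]? = some 0) || T (a.1, v))
    (some 0) (cond ((binaryWords a.1.length).all fun v =>
      decide (v[a.2.unpair.1]? = some 1) || T (a.1, v)) (some 1) none)

theorem computable_bitOfWord {T : List ℕ × List ℕ → Bool} (hT : Computable T) :
    Computable (bitOfWord T) := by
  have h : ∀ c : ℕ, Computable fun a : List ℕ × ℕ => (binaryWords a.1.length).all fun v =>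
      decide (v[a.2.unpair.1]? = some c) || T (a.1, v) := by
    intro c
    refine computable_list_all (p := fun z : (List ℕ × ℕ) × List ℕ =>
      decide (z.2[z.1.2.unpair.1]? = some c) || T (z.1.1, z.2))
      (computable_binaryWords.comp (Computable.list_length.comp Computable.fst)) ?_
    refine computable_or (computable_beq (computable_getElem? Computable.snd
      (Computable.fst.comp (Computable.unpair.comp (Computable.snd.comp Computable.fst))))
      (Computable.const _)) (hT.comp (Computable.pair (Computable.fst.comp Computable.fst)
        Computable.snd))
  exact Computable.cond (h 0) (Computable.const _)
    (Computable.cond (h 1) (Computable.const _) (Computable.const _))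

/-- The word of the true preimage passes no separation test, so it must itself carry the bit on
which all unseparated words agree. -/
theorem eq_of_bitOfWord {T : List ℕ × List ℕ → Bool} {z : ℕ → ℕ} {b : ℕ → Bool} {n m c : ℕ}
    (hT : T (initSeg z n, initSeg (bits b) n) = false)
    (h : bitOfWord T (initSeg z n, m) = some c) : c = bits b m.unpair.1 := by
  have key : ∀ c', ((binaryWords n).all fun v => decide (v[m.unpair.1]? = some c') ||
      T (initSeg z n, v)) = true → bits b m.unpair.1 = c' := by
    intro c' hc
    have := List.all_eq_true.1 hc _ (mem_binaryWords.2 ⟨b, rfl⟩)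
    rw [hT, Bool.or_false, decide_eq_true_eq] at this
    exact (getElem?_initSeg_eq_some.1 this).2
  simp only [bitOfWord, length_initSeg] at h
  cases h0 : (binaryWords n).all fun v => decide (v[m.unpair.1]? = some 0) ||
      T (initSeg z n, v) with
  | true =>
    rw [h0, cond_true] at h
    rw [key 0 h0, ← Option.some_injective _ h]
  | false =>
    rw [h0, cond_false] at h
    cases h1 : (binaryWords n).all fun v => decide (v[m.unpair.1]? = some 1) ||
        T (initSeg z n, v) with
    | true =>
      rw [h1, cond_true] at h
      rw [key 1 h1, ← Option.some_injective _ h]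
    | false => rw [h1] at h; cases h

theorem isSome_bitOfWord {T : List ℕ × List ℕ → Bool} {z : ℕ → ℕ} {n m : ℕ} (c : Bool)
    (h : ∀ b, (initSeg (bits b) n)[m.unpair.1]? = some c.toNat ∨
      T (initSeg z n, initSeg (bits b) n) = true) : (bitOfWord T (initSeg z n, m)).isSome := by
  have h' : ((binaryWords n).all fun v => decide (v[m.unpair.1]? = some c.toNat) ||
      T (initSeg z n, v)) = true := by
    rw [List.all_eq_true]
    intro v hv
    obtain ⟨b, rfl⟩ := mem_binaryWords.1 hv
    simpa using h b
  simp only [bitOfWord, length_initSeg]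
  cases c
  · rw [Bool.toNat_false] at h'
    rw [h']; rfl
  · rw [Bool.toNat_true] at h'
    rw [h']
    cases (binaryWords n).all fun v => decide (v[m.unpair.1]? = some 0) ||
      T (initSeg z n, v) <;> rfl

/-! ### Reduction of parallel `LLPO` to compact choice on a rich space -/

namespace ComputableMetric

variable {X : Type*} [MetricSpace X] (C : ComputableMetric X)

/-- A cover of `K` is recognized at all sufficiently late levels: each `b` either violates the
instances or is mapped into a ball of the cover, and both are visible from finitely many bits, so
`fan` applies. -/
theorem exists_mem_produce_coverOfWord {T : List (ℕ × ℕ × ℕ) × List ℕ → Bool}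
    {ι : (ℕ → Bool) → X} (hmono : ∀ w u v, u <+: v → T (w, u) = true → T (w, v) = true)
    (hT : ∀ w b, (∃ n, T (w, initSeg (bits b) n) = true) ↔ ∃ t ∈ w, ι b ∈ C.ratBall t)
    (p : ℕ → ℕ) (K : TopologicalSpace.Compacts X) (hK : (K : Set X) = ι '' solutions p) :
    ∃ q ∈ ofWords (produce (coverOfWord T)) p, C.compactRep.IsName q K := by
  have key : ∀ w, C.IsCover w (K : Set X) → ∀ N, ∃ n, N ≤ n ∧ ∀ m,
      coverOfWord T (initSeg p n, m) = some (Encodable.encode w) := by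
    intro w hw N
    obtain ⟨N₀, hN₀⟩ := fan (U := fun n b => violates (initSeg p n) (initSeg (bits b) n) = true ∨
        T (w, initSeg (bits b) n) = true)
      (fun n b b' hbb' h => by
        rwa [initSeg_congr (p := bits b') (q := bits b) fun i hi => by simp [bits, hbb' i hi]])
      (fun m n b hmn h => h.imp
        (violates_mono (initSeg_prefix _ hmn) (initSeg_prefix _ hmn))
        (hmono _ _ _ (initSeg_prefix _ hmn)))
      (fun b => by
        by_cases hb : b ∈ solutions p
        · have h1 : ι b ∈ (K : Set X) := hK ▸ ⟨b, hb, rfl⟩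
          obtain ⟨t, ht, hbt⟩ := Set.mem_iUnion₂.1 (hw h1)
          obtain ⟨n, hn⟩ := (hT w b).2 ⟨t, ht, hbt⟩
          exact ⟨n, Or.inr hn⟩
        · obtain ⟨n, hn⟩ := exists_violates_iff.2 hb
          exact ⟨n, Or.inl hn⟩)
    -- Round `n` tests the list coded by `n.unpair.1`, so every list is tested again at arbitrarily
    -- late levels.
    have hle := Nat.right_le_pair (Encodable.encode w) (max N N₀)
    refine ⟨Nat.pair (Encodable.encode w) (max N N₀), by omega, fun m => ?_⟩
    rw [coverOfWord_eq_some, Nat.unpair_pair]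
    refine ⟨rfl, ?_⟩
    rw [Denumerable.ofNat_encode]
    exact hN₀ _ (by omega)
  obtain ⟨q, hq, hq1, hq2⟩ := exists_mem_produce (g := coverOfWord T) (p := p) (by
    intro m N
    obtain ⟨w, hw, -⟩ := C.exists_cover K.isCompact (ε := fun _ => 1) (fun _ _ => one_pos)
    obtain ⟨n, hn, h⟩ := key w hw N
    exact ⟨n, hn, by rw [h]; rfl⟩)
  refine ⟨q, hq, ?_⟩
  change Set.range q = _
  ext c
  constructor
  · rintro ⟨m, rfl⟩
    obtain ⟨n, hn⟩ := hq1 m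
    obtain ⟨h1, h2⟩ := coverOfWord_eq_some.1 hn
    refine ⟨Denumerable.ofNat _ n.unpair.1, fun x hx => ?_, by rw [Denumerable.encode_ofNat, h1]⟩
    rw [hK] at hx
    obtain ⟨b, hb, rfl⟩ := hx
    rcases h2 b with h | h
    · exact absurd hb (exists_violates_iff.1 ⟨n, h⟩)
    · obtain ⟨t, ht, hbt⟩ := (hT _ b).1 ⟨n, h⟩
      exact Set.mem_iUnion₂.2 ⟨t, ht, hbt⟩
  · rintro ⟨w, hw, rfl⟩
    -- The proposal does not depend on the output position, so whichever position this round fills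
    -- receives the code of `w`. The bound 1 excludes round 0, which writes nothing.
    obtain ⟨n, hn, h⟩ := key w hw 1
    obtain ⟨n, rfl⟩ : ∃ k, n = k + 1 := ⟨n - 1, by omega⟩
    obtain ⟨m, hm⟩ := hq2 n
    exact ⟨m, hm _ (h _)⟩

/-- Any `b ≠ a` is eventually separated from the given point by injectivity, and `a` itself has the
right bit; `fan` makes this uniform in `b`, so the bit is found at a finite level. -/
theorem exists_mem_produce_bitOfWord {T : List ℕ × List ℕ → Bool} {ι : (ℕ → Bool) → X}
    (hι : Function.Injective ι)
    (hmono : ∀ u u' v v', u <+: u' → v <+: v' → T (u, v) = true → T (u', v') = true)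
    (hT : ∀ z x b, C.cauchyRep.IsName z x →
      ((∃ n, T (initSeg z n, initSeg (bits b) n) = true) ↔ x ≠ ι b))
    {z : ℕ → ℕ} {a : ℕ → Bool} (hz : C.cauchyRep.IsName z (ι a)) :
    ∃ q ∈ ofWords (produce (bitOfWord T)) z, natRep.seq.IsName q (bits a) := by
  obtain ⟨q, hq, hq1, -⟩ := exists_mem_produce (g := bitOfWord T) (p := z) (by
    intro m N
    obtain ⟨N₀, hN₀⟩ := fan (U := fun n b =>
        (initSeg (bits b) n)[m.unpair.1]? = some (bits a m.unpair.1) ∨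
          T (initSeg z n, initSeg (bits b) n) = true)
      (fun n b b' hbb' h => by
        rwa [initSeg_congr (p := bits b') (q := bits b) fun i hi => by simp [bits, hbb' i hi]])
      (fun m n b hmn h => h.imp (getElem?_of_prefix (initSeg_prefix _ hmn))
        (hmono _ _ _ _ (initSeg_prefix _ hmn) (initSeg_prefix _ hmn)))
      (fun b => by
        by_cases hb : b = a
        · exact ⟨m.unpair.1 + 1, Or.inl (hb ▸ getElem?_initSeg _ (Nat.lt_succ_self _))⟩
        · obtain ⟨n, hn⟩ := (hT z (ι a) b hz).2 fun h => hb (hι h).symm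
          exact ⟨n, Or.inr hn⟩)
    exact ⟨max N N₀, le_max_left _ _,
      isSome_bitOfWord (a m.unpair.1) (hN₀ _ (le_max_right _ _))⟩)
  refine ⟨q, hq, fun i => ?_⟩
  change q (Nat.pair i 0) = bits a i
  obtain ⟨n, hn⟩ := hq1 (Nat.pair i 0)
  have hTn : T (initSeg z n, initSeg (bits a) n) = false := by
    by_contra h
    exact (hT z (ι a) a hz).1 ⟨n, by simpa using h⟩ rfl
  rw [eq_of_bitOfWord hTn hn, Nat.unpair_pair]

theorem reducible_compactChoice (hC : C.IsRich) :
    StrongReducible LLPO.parallelization C.compactChoice := by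
  obtain ⟨ι, hι, hcomp⟩ := hC
  obtain ⟨f, Q, hf, hmono, hname, hQ, hQ'⟩ := C.exists_wordFun hcomp
  obtain ⟨T, hT, hTmono, hTspec⟩ := C.exists_covered hf hmono hname hQ hQ'
  obtain ⟨S, hS, hSmono, hSspec⟩ := C.exists_separated hf hmono hname hQ hQ'
  refine ⟨ofWords (produce (bitOfWord S)), ofWords (produce (coverOfWord T)),
    computableFun_produce (computable_bitOfWord hS),
    computableFun_produce (computable_coverOfWord hT), fun G hG p x hp hx => ?_⟩
  let K : TopologicalSpace.Compacts X :=
    ⟨ι '' solutions p, (isClosed_solutions p).isCompact.image (C.continuous_of_isComputable hcomp)⟩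
  obtain ⟨r, hr, hrK⟩ := C.exists_mem_produce_coverOfWord hTmono hTspec p K rfl
  obtain ⟨z, hz, y, hy, hzy⟩ := hG r K hrK ((solutions_nonempty hp hx).image ι)
  obtain ⟨a, ha, rfl⟩ : y ∈ ι '' solutions p := hy
  obtain ⟨q, hq, hqa⟩ := C.exists_mem_produce_bitOfWord hι hSmono hSspec hzy
  exact ⟨q, Part.mem_bind_iff.2 ⟨z, Part.mem_bind_iff.2 ⟨r, hr, hz⟩, hq⟩, bits a,
    bits_mem_parallelization hp hx ha, hqa⟩

end ComputableMetric

end CompAnalysis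

theorem mainTheorem11 {X : Type*} [MetricSpace X] (C : CompAnalysis.ComputableMetric X) :
    CompAnalysis.StrongReducible C.compactChoice CompAnalysis.LLPO.parallelization ∧
    (C.IsRich →
      CompAnalysis.StrongEquiv C.compactChoice CompAnalysis.LLPO.parallelization) :=
  ⟨C.compactChoice_reducible, fun h => ⟨C.compactChoice_reducible, C.reducible_compactChoice h⟩⟩
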